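/- **Setting.** Let $k$ be an algebraically closed field of characteristic $0$. A *fusion category* over $k$ is a $k$-linear abelian rigid monoidal category $\mathcal C$ (tensor product bilinear on morphisms) with simple unit object $\mathbf 1$ and finite-dimensional morphism spaces, having finitely many isomorphism classes of simple objects, such that every object is a finite direct sum of simple objects. Let $\mathcal C$ be a *modular fusion category*: a braided fusion category with a spherical pivotal structure such that the canonical functor $\mathcal C^{\mathrm{rev}}\boxtimes\mathcal C\to\mathcal Z(\mathcal C)$ to the Drinfeld center is an equivalence. This functor sends $a\boxtimes b$ to $a\otimes b$, with half-braiding given on $a$ by the inverse braiding and on $b$ by the braiding. Objects of $\mathcal Z(\mathcal C)$ are pairs $(Z,\gamma)$ with half-braiding $\gamma_U\colon Z\otimes U\to U\otimes Z$, and the braiding of $\mathcal Z(\mathcal C)$ is $c_{(Z,\gamma),(W,\gamma')}=\gamma_W$. We suppress associators of $\mathcal C$ and $\mathcal Z(\mathcal C)$. A Frobenius algebra $F=(F,\mu,\eta,\Delta,\varepsilon)$ in $\mathcal C$ is an algebra and coalgebra with $(\mu\otimes\mathrm{id})(\mathrm{id}\otimes\Delta)=\Delta\mu=(\mathrm{id}\otimes\mu)(\Delta\otimes\mathrm{id})$.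 It is *special* if $\dim F\neq0$, $\mu\Delta=\mathrm{id}_F$ and $\varepsilon\eta=\dim(F)\,\mathrm{id}_{\mathbf 1}$. It is *symmetric* if $$\big((\varepsilon\mu)\otimes\mathrm{id}_{F^\vee}\big)\big(\mathrm{id}_F\otimes\mathrm{coev}^r_F\big)=\big(\mathrm{id}_{F^\vee}\otimes(\varepsilon\mu)\big)\big(\mathrm{coev}^l_F\otimes\mathrm{id}_F\big)\colon F\to F^\vee,$$ with $\mathrm{coev}^r_F\colon\mathbf 1\to F\otimes F^\vee$ and $\mathrm{coev}^l_F\colon\mathbf 1\to F^\vee\otimes F$ the right and (via the pivotal structure) left coevaluations. It is *simple* if it is simple as a bimodule over itself. For an algebra $A$, right $A$-modules form a left $\mathcal C$-module category $\mathrm{mod}\text{-}A$. For an $A$-$B$-bimodule $X$ let $G^X=-\otimes_AX\colon\mathrm{mod}\text{-}A\to\mathrm{mod}\text{-}B$, a $\mathcal C$-module functor. For $Z=(\dot Z,\gamma)\in\mathcal Z(\mathcal C)$ and a $\mathcal C$-module functor $G$, let $Z\rhd G$ be the functor $M\mapsto\dot Z\otimes G(M)$ made a $\mathcal C$-module functor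 via $\gamma$; thus $\mathcal C$-module functors and module natural transformations form a left $\mathcal Z(\mathcal C)$-module category. For $A$-$B$-bimodules $X,Y$ let $\mathbb D^{X,Y}\in\mathcal Z(\mathcal C)$ be the internal Hom of $G^X$ and $G^Y$ in this module category (*internal natural transformations*): it represents $Z\mapsto\mathrm{Hom}(Z\rhd G^X,G^Y)$; let $\mathrm{ev}_{X,Y}\colon\mathbb D^{X,Y}\rhd G^X\to G^Y$ be the universal transformation. *Vertical composition.* $\mu_{\mathrm{ver}}\colon\mathbb D^{Y,W}\otimes\mathbb D^{X,Y}\to\mathbb D^{X,W}$ is the canonical composition of internal Homs, i.e. the morphism corresponding to $\mathrm{ev}_{Y,W}\circ(\mathrm{id}\rhd\mathrm{ev}_{X,Y})$. *Left horizontal composition.* For $X_1,X_3\in A\text{-mod-}A'$ and $X_2,X_4\in A'\text{-mod-}A''$, $$\mu_{\mathrm{hor}}^{\mathrm{left}}\colon\mathbb D^{X_2,X_4}\otimes\mathbb D^{X_1,X_3}\to\mathbb D^{X_1\otimes_{A'}X_2,\;X_3\otimes_{A'}X_4}$$ is the morphism corresponding to the transformation with component at $M\in\mathrm{mod}\text{-}A$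 $$\mathbb D^{X_2,X_4}\otimes\mathbb D^{X_1,X_3}\otimes G^{X_2}G^{X_1}M\cong\mathbb D^{X_2,X_4}\otimes G^{X_2}(\mathbb D^{X_1,X_3}\otimes G^{X_1}M)\to\mathbb D^{X_2,X_4}\otimes G^{X_2}G^{X_3}M\to G^{X_4}G^{X_3}M,$$ the two arrows being $\mathrm{id}\otimes G^{X_2}(\mathrm{ev}_{X_1,X_3})$ and $\mathrm{ev}_{X_2,X_4}$ at $G^{X_3}M$, under the canonical isomorphisms $G^{Y}\circ G^{X}\cong G^{X\otimes_{A'}Y}$. **Theorem (internal Eckmann–Hilton relation).** Let $\mathcal C$ be a modular fusion category over $k$ and let $A,A',A''$ be simple special symmetric Frobenius algebras in $\mathcal C$. Then for all $X_1,X_3,X_5\in A\text{-mod-}A'$ and all $X_2,X_4,X_6\in A'\text{-mod-}A''$ the following two morphisms $$\mathbb D^{X_4,X_6}\otimes\mathbb D^{X_2,X_4}\otimes\mathbb D^{X_3,X_5}\otimes\mathbb D^{X_1,X_3}\longrightarrow\mathbb D^{X_1\otimes_{A'}X_2,\;X_5\otimes_{A'}X_6}$$ in $\mathcal Z(\mathcal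 C)$ are equal: $$\mu_{\mathrm{hor}}^{\mathrm{left}}\circ(\mu_{\mathrm{ver}}\otimes\mu_{\mathrm{ver}})=\mu_{\mathrm{ver}}\circ(\mu_{\mathrm{hor}}^{\mathrm{left}}\otimes\mu_{\mathrm{hor}}^{\mathrm{left}})\circ\big(\mathrm{id}\otimes c_{\mathbb D^{X_2,X_4},\,\mathbb D^{X_3,X_5}}\otimes\mathrm{id}\big),$$ where $c_{\mathbb D^{X_2,X_4},\,\mathbb D^{X_3,X_5}}$ is the half-braiding of $\mathbb D^{X_2,X_4}$ at $\mathbb D^{X_3,X_5}$. -/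

import Mathlib

open CategoryTheory MonoidalCategory Limits MonoidalLeftAction
open Functor.LaxLeftLinear Functor.OplaxLeftLinear Functor.LeftLinear

universe w v u v₁ u₁ v₂ u₂ v₃ u₃

noncomputable section

attribute [local instance] Abelian.hasFiniteBiproducts

/-- A `C`-module functor structure on `F` built from natural isomorphisms
`c ⊙ F m ≅ F (c ⊙ m)` that satisfy the associativity and unit conditions. -/
@[reducible] def leftLinearMk {C : Type u} [Category.{v} C] [MonoidalCategory C]
    {M : Type u₁} [Category.{v₁} M] [MonoidalLeftAction C M]
    {N : Type u₂} [Category.{v₂} N] [MonoidalLeftAction C N] (F : M ⥤ N)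
    (e : ∀ (c : C) (m : M), c ⊙ₗ F.obj m ≅ F.obj (c ⊙ₗ m))
    (nat_left : ∀ {c c' : C} (f : c ⟶ c') (m : M),
      f ⊵ₗ F.obj m ≫ (e c' m).hom = (e c m).hom ≫ F.map (f ⊵ₗ m))
    (nat_right : ∀ (c : C) {m m' : M} (f : m ⟶ m'),
      c ⊴ₗ F.map f ≫ (e c m').hom = (e c m).hom ≫ F.map (c ⊴ₗ f))
    (assoc : ∀ (c c' : C) (m : M), (e (c ⊗ c') m).hom ≫ F.map (αₗ c c' m).hom =
      (αₗ c c' (F.obj m)).hom ≫ c ⊴ₗ (e c' m).hom ≫ (e c (c' ⊙ₗ m)).hom)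
    (unit : ∀ m : M, (λₗ (F.obj m)).hom = (e (𝟙_ C) m).hom ≫ F.map (λₗ m).hom) :
    F.LeftLinear C where
  μₗ c m := (e c m).hom
  δₗ c m := (e c m).inv
  μₗ_naturality_left := nat_left
  μₗ_naturality_right := nat_right
  μₗ_associativity := assoc
  μₗ_unitality := unit
  δₗ_naturality_left f m := by
    rw [← cancel_epi (e _ m).hom, ← reassoc_of% (nat_left f m)]; simp
  δₗ_naturality_right c _ _ f := by
    rw [← cancel_epi (e c _).hom, ← reassoc_of% (nat_right c f)]; simp
  δₗ_associativity c c' m := by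
    rw [← cancel_epi (e _ m).hom, reassoc_of% (assoc c c' m)]
    simp [← actionHomRight_comp]
  δₗ_unitality_inv m := by
    rw [← cancel_epi (λₗ[C] (F.obj m)).hom]
    nth_rw 2 [unit m]
    simp [← Functor.map_comp_assoc]
  μₗ_comp_δₗ := by simp
  δₗ_comp_μₗ := by simp

/-- A `C`-module functor between left module categories. -/
structure ModFun (C : Type u) [Category.{v} C] [MonoidalCategory C]
    (M : Type u₁) [Category.{v₁} M] [MonoidalLeftAction C M]
    (N : Type u₂) [Category.{v₂} N] [MonoidalLeftAction C N] where
  F : M ⥤ N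
  lin : F.LeftLinear C

namespace ModFun
variable {C : Type u} [Category.{v} C] [MonoidalCategory C]
    {M : Type u₁} [Category.{v₁} M] [MonoidalLeftAction C M]
    {N : Type u₂} [Category.{v₂} N] [MonoidalLeftAction C N]
    {P : Type u₃} [Category.{v₃} P] [MonoidalLeftAction C P]

attribute [instance] ModFun.lin

/-- A module natural transformation. -/
@[ext]
structure Hom (G H : ModFun C M N) where
  τ : G.F ⟶ H.F
  comm : ∀ (c : C) (m : M),
    μₗ G.F c m ≫ τ.app (c ⊙ₗ m) = c ⊴ₗ τ.app m ≫ μₗ H.F c m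

instance : Category (ModFun C M N) where
  Hom := Hom
  id G := ⟨𝟙 _, by simp⟩
  comp f g := ⟨f.τ ≫ g.τ, fun c m => by simp [reassoc_of% f.comm, g.comm]⟩

@[ext]
lemma hom_ext {G H : ModFun C M N} (f g : G ⟶ H) (h : ∀ m, f.τ.app m = g.τ.app m) : f = g :=
  Hom.ext (NatTrans.ext (funext h))

@[simp] lemma id_τ (G : ModFun C M N) : Hom.τ (𝟙 G) = 𝟙 G.F := rfl
@[simp] lemma comp_τ {G H K : ModFun C M N} (f : G ⟶ H) (g : H ⟶ K) :
    Hom.τ (f ≫ g) = f.τ ≫ g.τ := rfl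

/-- An isomorphism of module functors from a natural isomorphism that is a module
transformation. -/
def isoMk {G H : ModFun C M N} (e : G.F ≅ H.F) (h : ∀ (c : C) (m : M),
    μₗ G.F c m ≫ e.hom.app (c ⊙ₗ m) = c ⊴ₗ e.hom.app m ≫ μₗ H.F c m) : G ≅ H where
  hom := ⟨e.hom, h⟩
  inv := ⟨e.inv, fun c m => by
    rw [← cancel_mono (e.hom.app _), ← cancel_epi (c ⊴ₗ e.hom.app m)]
    simp [← actionHomRight_comp_assoc, h c m]⟩
  hom_inv_id := by ext; simp
  inv_hom_id := by ext; simp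

theorem half_unit {X : C} (b : HalfBraiding X) :
    (b.β (𝟙_ C)).hom = (ρ_ X).hom ≫ (λ_ X).inv := by
  have h := b.monoidal (𝟙_ C) (𝟙_ C)
  have h2 := b.naturality (λ_ (𝟙_ C)).hom
  rw [h] at h2
  have h5 : X ◁ (λ_ (𝟙_ C)).hom = (α_ _ _ _).inv ≫ (ρ_ _).hom := by monoidal
  have h4 : (λ_ (𝟙_ C)).hom ▷ X = (α_ _ _ _).hom ≫ (λ_ _).hom := by monoidal
  rw [h5, h4] at h2
  simp only [Category.assoc, Iso.cancel_iso_inv_left, Iso.inv_hom_id_assoc] at h2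
  rw [← rightUnitor_naturality, cancel_epi, leftUnitor_naturality] at h2
  rw [← cancel_epi (λ_ (X ⊗ 𝟙_ C)).hom, ← cancel_epi (α_ (𝟙_ C) X (𝟙_ C)).hom, ← h2]
  monoidal

theorem half_unit_inv {X : C} (b : HalfBraiding X) :
    (b.β (𝟙_ C)).inv = (λ_ X).hom ≫ (ρ_ X).inv := by
  rw [← cancel_epi (b.β (𝟙_ C)).hom, Iso.hom_inv_id, half_unit b]; simp

theorem half_nat_inv {X : C} (b : HalfBraiding X) {U V : C} (f : U ⟶ V) :
    f ▷ X ≫ (b.β V).inv = (b.β U).inv ≫ X ◁ f := by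
  rw [← cancel_epi (b.β U).hom, ← HalfBraiding.naturality_assoc]; simp

theorem half_monoidal_inv {X : C} (b : HalfBraiding X) (U V : C) :
    (b.β (U ⊗ V)).inv = (α_ _ _ _).hom ≫ U ◁ (b.β V).inv ≫ (α_ _ _ _).inv ≫
      (b.β U).inv ▷ V ≫ (α_ _ _ _).hom := by
  rw [← cancel_epi (b.β (U ⊗ V)).hom, Iso.hom_inv_id, HalfBraiding.monoidal]; simp

theorem act_exch_inv (x y : C) {n n' : N} (g : n ⟶ n') :
    x ⊴ₗ y ⊴ₗ g ≫ (αₗ x y n').inv = (αₗ x y n).inv ≫ (x ⊗ y) ⊴ₗ g := by simp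

theorem act_exch (x y : C) {n n' : N} (g : n ⟶ n') :
    (x ⊗ y) ⊴ₗ g ≫ (αₗ x y n').hom = (αₗ x y n).hom ≫ x ⊴ₗ y ⊴ₗ g := by simp

theorem act_coh₁ (x y z : C) (n : N) :
    (αₗ (x ⊗ y) z n).inv ≫ (α_ x y z).hom ⊵ₗ n ≫ (αₗ x (y ⊗ z) n).hom =
      (αₗ x y (z ⊙ₗ n)).hom ≫ x ⊴ₗ (αₗ y z n).inv := by
  rw [Iso.inv_comp_eq, ← associator_actionHom_assoc]; simp

theorem act_coh₂ (x y z : C) (n : N) :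
    (αₗ x (y ⊗ z) n).inv ≫ (α_ x y z).inv ⊵ₗ n ≫ (αₗ (x ⊗ y) z n).hom =
      x ⊴ₗ (αₗ y z n).hom ≫ (αₗ x y (z ⊙ₗ n)).inv := by
  rw [Iso.inv_comp_eq, ← cancel_epi ((α_ x y z).hom ⊵ₗ n), associator_actionHom_assoc]; simp

theorem act_coh₃ (x y z : C) (n : N) :
    (αₗ (x ⊗ y) z n).inv ≫ (α_ x y z).hom ⊵ₗ n ≫ (αₗ x (y ⊗ z) n).hom ≫
      x ⊴ₗ (αₗ y z n).hom = (αₗ x y (z ⊙ₗ n)).hom := by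
  rw [Iso.inv_comp_eq, associator_actionHom]

/-- The functor `m ↦ X ⊙ G m`, made a `C`-module functor with the help of a half-braiding
on `X`. -/
def actObj {X : C} (b : HalfBraiding X) (G : ModFun C M N) : ModFun C M N where
  F :=
    { obj m := X ⊙ₗ G.F.obj m
      map f := X ⊴ₗ G.F.map f }
  lin := leftLinearMk _ (fun c m =>
      (αₗ c X (G.F.obj m)).symm ≪≫
      { hom := (b.β c).inv ⊵ₗ G.F.obj m
        inv := (b.β c).hom ⊵ₗ G.F.obj m
        hom_inv_id := by simp [← comp_actionHomLeft]
        inv_hom_id := by simp [← comp_actionHomLeft] } ≪≫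
      (αₗ X c (G.F.obj m)) ≪≫
      { hom := X ⊴ₗ μₗ G.F c m
        inv := X ⊴ₗ δₗ G.F c m
        hom_inv_id := by simp [← actionHomRight_comp]
        inv_hom_id := by simp [← actionHomRight_comp] })
    (fun {c c'} f m => by
      dsimp
      simp only [Category.assoc]
      rw [← actionHomRight_comp, ← μₗ_naturality_left, actionHomRight_comp,
        actionHomLeft_action]
      simp only [Category.assoc, Iso.hom_inv_id_assoc, Iso.cancel_iso_inv_left]
      rw [← comp_actionHomLeft_assoc, half_nat_inv]
      simp)
    (fun c {m m'} f => by
      dsimp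
      simp only [Category.assoc]
      rw [← actionHomRight_comp, ← μₗ_naturality_right, actionHomRight_comp]
      rw [reassoc_of% @act_exch_inv, action_exchange_assoc, reassoc_of% @act_exch])
    (fun c c' m => by
      dsimp
      simp only [Category.assoc, half_monoidal_inv]
      rw [← actionHomRight_comp, μₗ_associativity]
      simp only [comp_actionHomLeft, actionHomRight_comp, whiskerLeft_actionHomLeft, whiskerRight_actionHomLeft, Category.assoc]
      rw [reassoc_of% @act_coh₁, reassoc_of% @act_coh₂, reassoc_of% @act_coh₃, reassoc_of% @act_exch_inv,
        action_exchange_assoc, reassoc_of% @act_exch])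
    (fun m => by
      dsimp
      simp only [Category.assoc, half_unit_inv]
      rw [← actionHomRight_comp, ← μₗ_unitality]
      simp [-μₗ_unitality, ← rightUnitor_actionHom, ← comp_actionHomLeft])

/-- The module functor `Z ⊙ G` for `Z` in the Drinfeld center. -/
def act (Z : Center C) (G : ModFun C M N) : ModFun C M N := actObj Z.2 G

theorem actObj_obj {X : C} (b : HalfBraiding X) (G : ModFun C M N) (m : M) :
    (actObj b G).F.obj m = X ⊙ₗ G.F.obj m := rfl

theorem actObj_μ {X : C} (b : HalfBraiding X) (G : ModFun C M N) (c : C) (m : M) :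
    μₗ (actObj b G).F c m = (αₗ c X (G.F.obj m)).inv ≫ (b.β c).inv ⊵ₗ G.F.obj m ≫
      (αₗ X c (G.F.obj m)).hom ≫ X ⊴ₗ μₗ G.F c m := rfl

/-- The module transformation `X ⊙ G ⟶ Y ⊙ G` induced by a morphism `X ⟶ Y` compatible with
half-braidings. -/
def actLeft {X Y : C} (b : HalfBraiding X) (b' : HalfBraiding Y) (f : X ⟶ Y)
    (hf : ∀ U : C, f ▷ U ≫ (b'.β U).hom = (b.β U).hom ≫ U ◁ f) (G : ModFun C M N) :
    actObj b G ⟶ actObj b' G where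
  τ := { app m := f ⊵ₗ G.F.obj m
         naturality m m' g := action_exchange _ _ }
  comm c m := by
    have h : c ◁ f ≫ (b'.β c).inv = (b.β c).inv ≫ f ▷ c := by
      rw [← cancel_epi (b.β c).hom, Iso.hom_inv_id_assoc, ← Category.assoc, Iso.comp_inv_eq, hf]
    change _ ≫ f ⊵ₗ G.F.obj (c ⊙ₗ m) = c ⊴ₗ f ⊵ₗ G.F.obj m ≫ _
    rw [actObj_μ, actObj_μ]
    have h1 : c ⊴ₗ f ⊵ₗ G.F.obj m ≫ (αₗ c Y (G.F.obj m)).inv =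
      (αₗ c X (G.F.obj m)).inv ≫ (c ◁ f) ⊵ₗ G.F.obj m := by simp
    rw [reassoc_of% h1, ← comp_actionHomLeft_assoc, h]
    simp only [Category.assoc, action_exchange]
    simp

/-- The module transformation `X ⊙ G ⟶ X ⊙ H` induced by `G ⟶ H`. -/
def actRight {X : C} (b : HalfBraiding X) {G H : ModFun C M N} (f : G ⟶ H) : actObj b G ⟶ actObj b H where
  τ := { app m := X ⊴ₗ f.τ.app m
         naturality m m' g := by
          change X ⊴ₗ G.F.map g ≫ X ⊴ₗ f.τ.app m' = X ⊴ₗ f.τ.app m ≫ X ⊴ₗ H.F.map g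
          simp [← actionHomRight_comp] }
  comm c m := by
    change _ ≫ X ⊴ₗ f.τ.app (c ⊙ₗ m) = c ⊴ₗ X ⊴ₗ f.τ.app m ≫ _
    rw [actObj_μ, actObj_μ]
    simp only [Category.assoc]
    rw [← actionHomRight_comp, f.comm, reassoc_of% @act_exch_inv, action_exchange_assoc,
      reassoc_of% @act_exch, ← actionHomRight_comp]

theorem comm_unit (G : ModFun C M N) (b : HalfBraiding (𝟙_ C)) (hb : ∀ U, (b.β U).hom = (λ_ U).hom ≫ (ρ_ U).inv)
    (c : C) (m : M) :
    μₗ (actObj b G).F c m ≫ (λₗ (G.F.obj (c ⊙ₗ m))).hom = c ⊴ₗ (λₗ (G.F.obj m)).hom ≫ μₗ G.F c m := by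
  have hb' : (b.β c).inv = (ρ_ c).hom ≫ (λ_ c).inv := by
    rw [← cancel_epi (b.β c).hom, Iso.hom_inv_id, hb]; simp
  have h1 : (λ_ c).inv ⊵ₗ G.F.obj m = (λₗ _).inv ≫ (αₗ _ _ _).inv := by
    rw [← cancel_epi ((λ_ c).hom ⊵ₗ G.F.obj m), ← comp_actionHomLeft]; simp
  rw [actObj_μ, hb', comp_actionHomLeft, rightUnitor_actionHom, h1]
  simp [actObj_obj, -μₗ_unitality, -δₗ_unitality_inv]

theorem comm_assoc (G : ModFun C M N) {X Y : C} (b : HalfBraiding X) (b' : HalfBraiding Y)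
    (b'' : HalfBraiding (X ⊗ Y))
    (hb : ∀ U, (b''.β U).inv = (α_ _ _ _).inv ≫ (b.β U).inv ▷ Y ≫ (α_ _ _ _).hom ≫
      X ◁ (b'.β U).inv ≫ (α_ _ _ _).inv) (c : C) (m : M) :
    μₗ (actObj b'' G).F c m ≫ (αₗ X Y (G.F.obj (c ⊙ₗ m))).hom =
      c ⊴ₗ (αₗ X Y (G.F.obj m)).hom ≫ μₗ (actObj b (actObj b' G)).F c m := by
  rw [actObj_μ, actObj_μ, actObj_μ, hb]
  simp only [comp_actionHomLeft, actionHomRight_comp, whiskerLeft_actionHomLeft, whiskerRight_actionHomLeft, Category.assoc, actObj_obj]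
  rw [reassoc_of% @act_coh₂, reassoc_of% @act_coh₁, reassoc_of% @act_coh₂, act_exch]
  simp

theorem tensor_inv (Z W : Center C) (U : C) : ((Z ⊗ W).2.β U).inv =
   (α_ _ _ _).inv ≫ (Z.2.β U).inv ▷ W.1 ≫ (α_ _ _ _).hom ≫
      Z.1 ◁ (W.2.β U).inv ≫ (α_ _ _ _).inv := by
  rw [Center.tensor_β]
  simp

/-- The category of `C`-module functors is a left module category over the Drinfeld center. -/
instance : MonoidalLeftAction (Center C) (ModFun C M N) where
  actionObj := act
  actionHomLeft f G := actLeft _ _ f.f f.comm G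
  actionHomRight Z {_ _} f := actRight Z.2 f
  actionAssocIso Z W G := isoMk (NatIso.ofComponents (fun m => αₗ Z.1 W.1 (G.F.obj m))
    (fun f => act_exch _ _ _)) (comm_assoc G Z.2 W.2 (Z ⊗ W).2 (tensor_inv Z W))
  actionUnitIso G := isoMk (NatIso.ofComponents (fun m => λₗ (G.F.obj m))
    (fun f => (actionUnitIso_hom_naturality _).symm)) (comm_unit G (𝟙_ (Center C)).2 (fun _ => rfl))
  actionHomRight_id Z G := by ext m; exact actionHomRight_id _ _
  id_actionHomLeft Z G := by ext m; exact id_actionHomLeft _ _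
  actionHom_comp f₁ f₂ g₁ g₂ := by
    ext m
    have := actionHom_comp f₁.f f₂.f (g₁.τ.app m) (g₂.τ.app m)
    simp only [actionHom_def] at this
    exact this
  actionAssocIso_hom_naturality f g h := by
    ext m
    have := actionAssocIso_hom_naturality f.f g.f (h.τ.app m)
    simp only [actionHom_def, MonoidalCategory.tensorHom_def] at this ⊢
    exact this
  actionUnitIso_hom_naturality f := by ext m; exact actionUnitIso_hom_naturality _
  whiskerLeft_actionHomLeft Z W V f G := by ext m; exact whiskerLeft_actionHomLeft _ _ _
  whiskerRight_actionHomLeft V f G := by ext m; exact whiskerRight_actionHomLeft _ _ _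
  associator_actionHom := by intros; ext m; exact associator_actionHom _ _ _ _
  leftUnitor_actionHom := by intros; ext m; exact leftUnitor_actionHom _ _
  rightUnitor_actionHom := by intros; ext m; exact rightUnitor_actionHom _ _

/-- Composition of module functors, `G` first. -/
def comp (G : ModFun C M N) (H : ModFun C N P) : ModFun C M P where
  F := G.F ⋙ H.F
  lin := leftLinearMk _ (fun c m => μₗIso H.F c (G.F.obj m) ≪≫ H.F.mapIso (μₗIso G.F c m))
    (fun f m => by simp [← Functor.map_comp])
    (fun c {m m'} f => by simp [← Functor.map_comp])
    (fun c c' m => by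
      dsimp
      simp only [Category.assoc, actionHomRight_comp, μₗ_naturality_right_assoc, ← Functor.map_comp, ← μₗ_associativity_assoc, μₗ_associativity])
    (fun m => by simp [← Functor.map_comp])

theorem comp_μ (G : ModFun C M N) (H : ModFun C N P) (c : C) (m : M) :
    μₗ (comp G H).F c m = μₗ H.F c (G.F.obj m) ≫ H.F.map (μₗ G.F c m) := rfl

/-- The transformation with components `f` at `G m`. -/
def whiskerL (G : ModFun C M N) {H K : ModFun C N P} (f : H ⟶ K) : comp G H ⟶ comp G K where
  τ := Functor.whiskerLeft G.F f.τ
  comm c m := by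
    rw [comp_μ, comp_μ]
    change _ ≫ f.τ.app _ = c ⊴ₗ f.τ.app _ ≫ _
    simp [reassoc_of% f.comm]

/-- The transformation with components `K (f m)`. -/
def whiskerR {G H : ModFun C M N} (f : G ⟶ H) (K : ModFun C N P) : comp G K ⟶ comp H K where
  τ := Functor.whiskerRight f.τ K.F
  comm c m := by
    rw [comp_μ, comp_μ]
    change _ ≫ K.F.map (f.τ.app _) = c ⊴ₗ K.F.map (f.τ.app _) ≫ _
    simp [← Functor.map_comp, f.comm]

/-- The module constraint of `H` as a transformation `Z ⊙ (G then H) ⟶ (Z ⊙ G) then H`. -/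
def actComp (Z : Center C) (G : ModFun C M N) (H : ModFun C N P) : Z ⊙ₗ comp G H ⟶ comp (Z ⊙ₗ G) H where
  τ := { app m := μₗ H.F Z.1 (G.F.obj m)
         naturality m m' f := μₗ_naturality_right H.F Z.1 (G.F.map f) }
  comm c m := by
    have key : ∀ {X : C} (b : HalfBraiding X),
        ((αₗ c X (H.F.obj (G.F.obj m))).inv ≫ (b.β c).inv ⊵ₗ H.F.obj (G.F.obj m) ≫
          (αₗ X c (H.F.obj (G.F.obj m))).hom ≫ X ⊴ₗ (μₗ H.F c (G.F.obj m) ≫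
            H.F.map (μₗ G.F c m))) ≫ μₗ H.F X (G.F.obj (c ⊙ₗ m)) =
        c ⊴ₗ μₗ H.F X (G.F.obj m) ≫ μₗ H.F c (X ⊙ₗ G.F.obj m) ≫
          H.F.map ((αₗ c X (G.F.obj m)).inv ≫ (b.β c).inv ⊵ₗ G.F.obj m ≫
            (αₗ X c (G.F.obj m)).hom ≫ X ⊴ₗ μₗ G.F c m) := by
      intro X b
      simp only [Functor.map_comp, actionHomRight_comp, Category.assoc, μₗ_naturality_right,
        μₗ_associativity_inv_assoc, ← μₗ_naturality_left_assoc]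
      rw [← reassoc_of% (μₗ_associativity H.F X c (G.F.obj m))]
    exact key Z.2

/-- The identity, as a transformation `Z ⊙ (G then H) ⟶ G then (Z ⊙ H)`. -/
def compAct (Z : Center C) (G : ModFun C M N) (H : ModFun C N P) : Z ⊙ₗ comp G H ⟶ comp G (Z ⊙ₗ H) where
  τ := { app m := 𝟙 _
         naturality m m' f := (Category.comp_id _).trans (Category.id_comp _).symm }
  comm c m := by
    have key : ∀ {X : C} (b : HalfBraiding X),
        ((αₗ c X (H.F.obj (G.F.obj m))).inv ≫ (b.β c).inv ⊵ₗ H.F.obj (G.F.obj m) ≫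
          (αₗ X c (H.F.obj (G.F.obj m))).hom ≫ X ⊴ₗ (μₗ H.F c (G.F.obj m) ≫
            H.F.map (μₗ G.F c m))) ≫ 𝟙 (X ⊙ₗ H.F.obj (G.F.obj (c ⊙ₗ m))) =
        c ⊴ₗ 𝟙 (X ⊙ₗ H.F.obj (G.F.obj m)) ≫ ((αₗ c X (H.F.obj (G.F.obj m))).inv ≫
          (b.β c).inv ⊵ₗ H.F.obj (G.F.obj m) ≫ (αₗ X c (H.F.obj (G.F.obj m))).hom ≫
            X ⊴ₗ μₗ H.F c (G.F.obj m)) ≫ X ⊴ₗ H.F.map (μₗ G.F c m) := by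
      intro X b
      simp
    exact key Z.2

/-- The left horizontal composite of `f : Z ⊙ G₂ ⟶ G₄` and `g : W ⊙ G₁ ⟶ G₃`: its component at
`m` applies `G₂` to the component of `g` at `m` (using the module constraint of `G₂` to move `W`
past `G₂`), and then the component of `f` at `G₃ m`. -/
def hcompL (G₁ G₃ : ModFun C M N) (G₂ G₄ : ModFun C N P) (Z W : Center C) (f : Z ⊙ₗ G₂ ⟶ G₄) (g : W ⊙ₗ G₁ ⟶ G₃) :
   (Z ⊗ W) ⊙ₗ comp G₁ G₂ ⟶ comp G₃ G₄ :=
  (αₗ Z W (comp G₁ G₂)).hom ≫ Z ⊴ₗ actComp W G₁ G₂ ≫ Z ⊴ₗ whiskerR g G₂ ≫ compAct Z G₃ G₂ ≫ whiskerL G₃ f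
end ModFun

/-- An internal Hom object of `m` and `n` in a left module category over `V`: an object
representing `v ↦ (v ⊙ m ⟶ n)`. -/
structure InternalHom (V : Type u) [Category.{v} V] [MonoidalCategory V]
    {M : Type u₁} [Category.{v₁} M] [MonoidalLeftAction V M] (m n : M) where
  obj : V
  ev : obj ⊙ₗ m ⟶ n
  curry {v : V} (f : v ⊙ₗ m ⟶ n) : v ⟶ obj
  curry_ev {v : V} (f : v ⊙ₗ m ⟶ n) : curry f ⊵ₗ m ≫ ev = f
  uniq {v : V} (f : v ⊙ₗ m ⟶ n) (g : v ⟶ obj) : g ⊵ₗ m ≫ ev = f → g = curry f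

namespace InternalHom
variable {V : Type u} [Category.{v} V] [MonoidalCategory V]
    {M : Type u₁} [Category.{v₁} M] [MonoidalLeftAction V M]
/-- The canonical composition of internal Homs. -/
def mul {l m n : M} (a : InternalHom V m n) (b : InternalHom V l m) (c : InternalHom V l n) : a.obj ⊗ b.obj ⟶ c.obj :=
  c.curry ((αₗ _ _ _).hom ≫ a.obj ⊴ₗ b.ev ≫ a.ev)
end InternalHom

section Rigid
variable {C : Type u} [Category.{v} C] [MonoidalCategory C] [RigidCategory C]
instance (X : C) : PreservesColimitsOfSize.{0, 0} (tensorLeft X) :=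
  (tensorLeftAdjunction (ᘁX) X).leftAdjoint_preservesColimits
instance (X : C) : PreservesColimitsOfSize.{0, 0} (tensorRight X) :=
  (tensorRightAdjunction X Xᘁ).leftAdjoint_preservesColimits
end Rigid

/-- Right modules over an algebra `A`. -/
structure RightMod {C : Type u} [Category.{v} C] [MonoidalCategory C] (A : Mon C) where
  X : C
  act : X ⊗ A.X ⟶ X
  act_one : X ◁ MonObj.one ≫ act = (ρ_ X).hom
  act_mul : X ◁ MonObj.mul ≫ act = (α_ X A.X A.X).inv ≫ act ▷ A.X ≫ act

namespace RightMod
section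
variable {C : Type u} [Category.{v} C] [MonoidalCategory C] {A B : Mon C}

/-- Morphisms of right modules. -/
@[ext]
structure Hom (M N : RightMod A) where
  hom : M.X ⟶ N.X
  comm : M.act ≫ hom = hom ▷ A.X ≫ N.act

instance : Category (RightMod A) where
  Hom := Hom
  id M := ⟨𝟙 _, by simp⟩
  comp f g := ⟨f.hom ≫ g.hom, by simp [reassoc_of% f.comm, g.comm]⟩

@[ext]
lemma hom_ext {M N : RightMod A} (f g : M ⟶ N) (h : f.hom = g.hom) : f = g :=
  Hom.ext h

@[simp] lemma id_hom (M : RightMod A) : Hom.hom (𝟙 M) = 𝟙 M.X := rfl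
@[simp] lemma comp_hom {M N K : RightMod A} (f : M ⟶ N) (g : N ⟶ K) :
    Hom.hom (f ≫ g) = f.hom ≫ g.hom := rfl

@[simps]
def isoMk {M N : RightMod A} (e : M.X ≅ N.X) (h : M.act ≫ e.hom = e.hom ▷ A.X ≫ N.act) : M ≅ N where
  hom := ⟨e.hom, h⟩
  inv := ⟨e.inv, by
    rw [← cancel_mono e.hom, ← cancel_epi (e.hom ▷ A.X)]
    simp [h]⟩
  hom_inv_id := by ext; simp
  inv_hom_id := by ext; simp

/-- The right module `c ⊗ M`. -/
abbrev smul (c : C) (M : RightMod A) : RightMod A where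
  X := c ⊗ M.X
  act := (α_ c M.X A.X).hom ≫ c ◁ M.act
  act_one := by
    rw [associator_naturality_right_assoc, ← MonoidalCategory.whiskerLeft_comp, M.act_one]
    monoidal
  act_mul := by
    rw [associator_naturality_right_assoc, ← MonoidalCategory.whiskerLeft_comp, M.act_mul]
    simp

/-- Right modules form a left module category over `C`. -/
instance : MonoidalLeftAction C (RightMod A) where
  actionObj := smul
  actionHomLeft f M := ⟨f ▷ M.X, by simp [smul, whisker_exchange]⟩
  actionHomRight c {M N} f := ⟨c ◁ f.hom, by
    simp [← MonoidalCategory.whiskerLeft_comp, f.comm]⟩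
  actionAssocIso c d M := isoMk (α_ c d M.X) (by simp [smul])
  actionUnitIso M := isoMk (λ_ M.X) (by simp [smul])
  actionHom_comp f₁ f₂ g₁ g₂ := by
    ext
    have := MonoidalCategory.tensorHom_comp_tensorHom f₁ g₁.hom f₂ g₂.hom
    simp only [MonoidalCategory.tensorHom_def] at this
    exact this.symm
  actionHomRight_id c M := by ext; exact MonoidalCategory.whiskerLeft_id _ _
  id_actionHomLeft c M := by ext; exact MonoidalCategory.id_whiskerRight _ _
  actionAssocIso_hom_naturality f g h := by
    ext
    have := MonoidalCategory.associator_naturality f g h.hom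
    simp only [MonoidalCategory.tensorHom_def] at this ⊢
    exact this
  actionUnitIso_hom_naturality f := by ext; exact (leftUnitor_naturality f.hom).symm
  whiskerLeft_actionHomLeft c _ _ f M := by ext; exact whisker_assoc _ _ _
  whiskerRight_actionHomLeft c f M := by ext; exact MonoidalCategory.whiskerRight_tensor_symm _ _ _
  associator_actionHom c₁ c₂ c₃ M := by ext; exact pentagon _ _ _ _
  leftUnitor_actionHom c M := by ext; exact leftUnitor_whiskerRight _ _
  rightUnitor_actionHom c M := by ext; exact (MonoidalCategory.triangle c M.X).symm

end
section
variable {C : Type u} [Category.{v} C] [MonoidalCategory C] [RigidCategory C] [HasCoequalizers C]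
  {A B D : Mon C}

/-- The object `M ⊗_A X`. -/
def tens (M : RightMod A) (X : Bimod A B) : C :=
  coequalizer (M.act ▷ X.X) ((α_ M.X A.X X.X).hom ≫ M.X ◁ X.actLeft)

/-- The projection onto `M ⊗_A X`. -/
def pr (M : RightMod A) (X : Bimod A B) : M.X ⊗ X.X ⟶ tens M X :=
  coequalizer.π (M.act ▷ X.X) ((α_ M.X A.X X.X).hom ≫ M.X ◁ X.actLeft)

theorem pr_cond (M : RightMod A) (X : Bimod A B) : M.act ▷ X.X ≫ pr M X = (α_ M.X A.X X.X).hom ≫ M.X ◁ X.actLeft ≫ pr M X := by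
  have := coequalizer.condition (M.act ▷ X.X) ((α_ M.X A.X X.X).hom ≫ M.X ◁ X.actLeft)
  rw [Category.assoc] at this
  exact this

instance (M : RightMod A) (X : Bimod A B) : Epi (pr M X) :=
  coequalizer.π_epi
instance (M : RightMod A) (X : Bimod A B) (c : C) : Epi (c ◁ pr M X) :=
  inferInstanceAs (Epi ((tensorLeft c).map (pr M X)))
instance (M : RightMod A) (X : Bimod A B) (c d : C) : Epi ((c ◁ pr M X) ▷ d) :=
  inferInstanceAs (Epi ((tensorRight d).map ((tensorLeft c).map (pr M X))))
instance (M : RightMod A) (X : Bimod A B) (c d : C) : Epi (c ◁ d ◁ pr M X) :=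
  inferInstanceAs (Epi ((tensorLeft c).map ((tensorLeft d).map (pr M X))))
instance (M : RightMod A) (X : Bimod A B) (c d : C) : Epi (pr M X ▷ c ▷ d) :=
  inferInstanceAs (Epi ((tensorRight d).map ((tensorRight c).map (pr M X))))
instance (M : RightMod A) (X : Bimod A B) (c : C) : Epi (pr M X ▷ c) :=
  inferInstanceAs (Epi ((tensorRight c).map (pr M X)))

def desc (M : RightMod A) (X : Bimod A B) {W : C} (h : M.X ⊗ X.X ⟶ W)
    (wh : M.act ▷ X.X ≫ h = (α_ M.X A.X X.X).hom ≫ M.X ◁ X.actLeft ≫ h) : tens M X ⟶ W :=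
  coequalizer.desc h (by simpa using wh)

@[simp]
theorem pr_desc (M : RightMod A) (X : Bimod A B) {W : C} (h : M.X ⊗ X.X ⟶ W)
    (wh : M.act ▷ X.X ≫ h = (α_ M.X A.X X.X).hom ≫ M.X ◁ X.actLeft ≫ h) : pr M X ≫ desc M X h wh = h :=
  coequalizer.π_desc _ _

def descL (c : C) (M : RightMod A) (X : Bimod A B) {W : C} (h : c ⊗ M.X ⊗ X.X ⟶ W)
    (wh : c ◁ M.act ▷ X.X ≫ h = c ◁ (α_ M.X A.X X.X).hom ≫ c ◁ M.X ◁ X.actLeft ≫ h) : c ⊗ tens M X ⟶ W :=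
  (PreservesCoequalizer.iso (tensorLeft c) _ _).inv ≫ coequalizer.desc h (by simpa using wh)

@[simp]
theorem pr_descL (c : C) (M : RightMod A) (X : Bimod A B) {W : C} (h : c ⊗ M.X ⊗ X.X ⟶ W)
    (wh : c ◁ M.act ▷ X.X ≫ h = c ◁ (α_ M.X A.X X.X).hom ≫ c ◁ M.X ◁ X.actLeft ≫ h) :
    c ◁ pr M X ≫ descL c M X h wh = h :=
  id_tensor_π_preserves_coequalizer_inv_desc _ _ _ _

def descR (c : C) (M : RightMod A) (X : Bimod A B) {W : C} (h : (M.X ⊗ X.X) ⊗ c ⟶ W)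
    (wh : M.act ▷ X.X ▷ c ≫ h = (α_ M.X A.X X.X).hom ▷ c ≫ (M.X ◁ X.actLeft) ▷ c ≫ h) : tens M X ⊗ c ⟶ W :=
  (PreservesCoequalizer.iso (tensorRight c) _ _).inv ≫ coequalizer.desc h (by simpa using wh)

@[simp]
theorem pr_descR (c : C) (M : RightMod A) (X : Bimod A B) {W : C} (h : (M.X ⊗ X.X) ⊗ c ⟶ W)
    (wh : M.act ▷ X.X ▷ c ≫ h = (α_ M.X A.X X.X).hom ▷ c ≫ (M.X ◁ X.actLeft) ▷ c ≫ h) :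
    pr M X ▷ c ≫ descR c M X h wh = h :=
  π_tensor_id_preserves_coequalizer_inv_desc _ _ _ _

/-- `M ⊗_A X` as a right module. -/
abbrev tensMod (M : RightMod A) (X : Bimod A B) : RightMod B where
  X := tens M X
  act := descR B.X M X ((α_ _ _ _).hom ≫ M.X ◁ X.actRight ≫ pr M X) (by
    simp only [associator_naturality_left_assoc]
    rw [← whisker_exchange_assoc, pr_cond]
    simp only [associator_naturality_middle_assoc, ← MonoidalCategory.whiskerLeft_comp_assoc,
      X.middle_assoc]
    simp)
  act_one := by
    rw [← cancel_epi (pr M X ▷ 𝟙_ C), ← whisker_exchange_assoc, pr_descR,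
      associator_naturality_right_assoc, ← MonoidalCategory.whiskerLeft_comp_assoc,
      X.actRight_one, rightUnitor_naturality]
    monoidal
  act_mul := by
    rw [← cancel_epi (pr M X ▷ (B.X ⊗ B.X)), ← whisker_exchange_assoc, pr_descR,
      associator_naturality_right_assoc, ← MonoidalCategory.whiskerLeft_comp_assoc,
      X.right_assoc, associator_inv_naturality_left_assoc, ← comp_whiskerRight_assoc, pr_descR]
    simp

theorem pr_act (M : RightMod A) (X : Bimod A B) : pr M X ▷ B.X ≫ (tensMod M X).act =
    (α_ _ _ _).hom ≫ M.X ◁ X.actRight ≫ pr M X := by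
  rw [pr_descR]

def tensMap {M N : RightMod A} (f : M ⟶ N) (X : Bimod A B) : tensMod M X ⟶ tensMod N X where
  hom := desc M X (f.hom ▷ X.X ≫ pr N X) (by
    rw [← MonoidalCategory.comp_whiskerRight_assoc, f.comm, MonoidalCategory.comp_whiskerRight_assoc, pr_cond]
    simp [whisker_exchange_assoc])
  comm := by
    change (tensMod M X).act ≫ desc M X _ _ = desc M X _ _ ▷ B.X ≫ _
    rw [← cancel_epi (pr M X ▷ B.X), reassoc_of% @pr_act, pr_desc, ← comp_whiskerRight_assoc, pr_desc,
      comp_whiskerRight_assoc, pr_act]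
    simp [whisker_exchange_assoc]

theorem pr_map {M N : RightMod A} (f : M ⟶ N) (X : Bimod A B) :
    pr M X ≫ (tensMap f X).hom = f.hom ▷ X.X ≫ pr N X := by
  rw [tensMap, pr_desc]

@[ext]
theorem tens_ext {M : RightMod A} {X : Bimod A B} {W : C} (f g : tens M X ⟶ W) (h : pr M X ≫ f = pr M X ≫ g) : f = g :=
  (cancel_epi _).1 h

def tensFunctor (X : Bimod A B) : RightMod A ⥤ RightMod B where
  obj M := tensMod M X
  map f := tensMap f X
  map_id M := by ext; rw [pr_map]; simp
  map_comp f g := by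
    ext
    rw [pr_map, comp_hom, comp_hom, reassoc_of% @pr_map, pr_map]; simp

theorem smul_pr_cond (c : C) (M : RightMod A) (X : Bimod A B) :
    c ◁ M.act ▷ X.X ≫ (α_ c M.X X.X).inv ≫ pr (c ⊙ₗ M) X =
      c ◁ (α_ M.X A.X X.X).hom ≫ c ◁ M.X ◁ X.actLeft ≫ (α_ c M.X X.X).inv ≫ pr (c ⊙ₗ M) X := by
  have := pr_cond (c ⊙ₗ M) X
  change ((α_ c M.X A.X).hom ≫ c ◁ M.act) ▷ X.X ≫ pr (c ⊙ₗ M) X =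
    (α_ (c ⊗ M.X) A.X X.X).hom ≫ (c ⊗ M.X) ◁ X.actLeft ≫ pr (c ⊙ₗ M) X at this
  rw [← cancel_epi (α_ c (M.X ⊗ A.X) X.X).hom, ← cancel_epi ((α_ c M.X A.X).hom ▷ X.X)]
  simpa using this

theorem whisker_pr_cond (c : C) (M : RightMod A) (X : Bimod A B) :
    c ◁ M.act ▷ X.X ≫ c ◁ pr M X =
      c ◁ (α_ M.X A.X X.X).hom ≫ c ◁ M.X ◁ X.actLeft ≫ c ◁ pr M X := by
  simp only [← MonoidalCategory.whiskerLeft_comp, pr_cond]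

def tensLinIso (c : C) (M : RightMod A) (X : Bimod A B) :
    c ⊗ tens M X ≅ tens (c ⊙ₗ M) X where
  hom := descL c M X ((α_ _ _ _).inv ≫ pr (c ⊙ₗ M) X) (smul_pr_cond c M X)
  inv := desc (c ⊙ₗ M) X ((α_ _ _ _).hom ≫ c ◁ pr M X) (by
    change ((α_ c M.X A.X).hom ≫ c ◁ M.act) ▷ X.X ≫ (α_ c M.X X.X).hom ≫ c ◁ pr M X =
      (α_ (c ⊗ M.X) A.X X.X).hom ≫ (c ⊗ M.X) ◁ X.actLeft ≫ (α_ c M.X X.X).hom ≫ c ◁ pr M X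
    simp [whisker_pr_cond])
  hom_inv_id := by
    rw [← cancel_epi (c ◁ pr M X), reassoc_of% @pr_descL, Category.assoc, pr_desc]
    exact (Iso.inv_hom_id_assoc _ _).trans (Category.comp_id _).symm
  inv_hom_id := by
    rw [← cancel_epi (pr (c ⊙ₗ M) X), reassoc_of% @pr_desc, Category.assoc, pr_descL]
    exact (Iso.hom_inv_id_assoc _ _).trans (Category.comp_id _).symm

theorem pr_linIso (c : C) (M : RightMod A) (X : Bimod A B) :
    c ◁ pr M X ≫ (tensLinIso c M X).hom = (α_ _ _ _).inv ≫ pr (c ⊙ₗ M) X :=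
  pr_descL _ _ _ _ (smul_pr_cond c M X)

/-- The module constraint `c ⊗ (M ⊗_A X) ≅ (c ⊗ M) ⊗_A X`. -/
def tensLin (c : C) (M : RightMod A) (X : Bimod A B) :
    c ⊙ₗ tensMod M X ≅ tensMod (c ⊙ₗ M) X :=
  isoMk (tensLinIso c M X) (by
      change ((α_ c (tensMod M X).X B.X).hom ≫ c ◁ (tensMod M X).act) ≫ (tensLinIso c M X).hom =
        (tensLinIso c M X).hom ▷ B.X ≫ (tensMod (c ⊙ₗ M) X).act
      rw [← cancel_epi ((c ◁ pr M X) ▷ B.X), ← comp_whiskerRight_assoc, pr_linIso, Category.assoc,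
        associator_naturality_middle_assoc, ← MonoidalCategory.whiskerLeft_comp_assoc, pr_act,
        comp_whiskerRight_assoc, pr_act]
      simp only [MonoidalCategory.whiskerLeft_comp, Category.assoc]
      rw [pr_linIso]
      change _ = _ ≫ (α_ (c ⊗ M.X) X.X B.X).hom ≫ (c ⊗ M.X) ◁ X.actRight ≫ pr (c ⊙ₗ M) X
      simp)

theorem pr_lin (c : C) (M : RightMod A) (X : Bimod A B) :
    c ◁ pr M X ≫ (tensLin c M X).hom.hom = (α_ _ _ _).inv ≫ pr (c ⊙ₗ M) X :=
  pr_linIso c M X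

/-- The module functor `- ⊗_A X` from right `A`-modules to right `B`-modules. -/
def tensFun (X : Bimod A B) : ModFun C (RightMod A) (RightMod B) where
  F := tensFunctor X
  lin := leftLinearMk _ (fun c M => tensLin c M X)
    (fun {c c'} f M => by
      ext
      change f ▷ (tensMod M X).X ≫ (tensLin c' M X).hom.hom =
        (tensLin c M X).hom.hom ≫ (tensMap (f ⊵ₗ M) X).hom
      rw [← cancel_epi (c ◁ pr M X), whisker_exchange_assoc, pr_lin, reassoc_of% @pr_lin, pr_map]
      change _ = _ ≫ (f ▷ M.X) ▷ X.X ≫ _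
      simp)
    (fun c {M N} f => by
      ext
      change c ◁ (tensMap f X).hom ≫ (tensLin c N X).hom.hom =
        (tensLin c M X).hom.hom ≫ (tensMap (c ⊴ₗ f) X).hom
      rw [← cancel_epi (c ◁ pr M X), ← MonoidalCategory.whiskerLeft_comp_assoc, pr_map,
        MonoidalCategory.whiskerLeft_comp_assoc, pr_lin, reassoc_of% @pr_lin, pr_map]
      change _ = _ ≫ (c ◁ f.hom) ▷ X.X ≫ _
      simp)
    (fun c c' M => by
      ext
      change (tensLin (c ⊗ c') M X).hom.hom ≫ (tensMap (αₗ c c' M).hom X).hom =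
        (α_ c c' (tensMod M X).X).hom ≫ c ◁ (tensLin c' M X).hom.hom ≫ (tensLin c (c' ⊙ₗ M) X).hom.hom
      rw [← cancel_epi ((c ⊗ c') ◁ pr M X), reassoc_of% @pr_lin, pr_map,
        associator_naturality_right_assoc, ← MonoidalCategory.whiskerLeft_comp_assoc, pr_lin,
        MonoidalCategory.whiskerLeft_comp_assoc, pr_lin]
      change _ ≫ (α_ c c' M.X).hom ▷ X.X ≫ pr (c ⊙ₗ c' ⊙ₗ M) X = _ ≫ _ ≫ (α_ c (c' ⊗ M.X) X.X).inv ≫ pr (c ⊙ₗ c' ⊙ₗ M) X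
      simp)
    (fun M => by
      ext
      change (λ_ (tensMod M X).X).hom = (tensLin (𝟙_ C) M X).hom.hom ≫ (tensMap (λₗ M).hom X).hom
      rw [← cancel_epi (𝟙_ C ◁ pr M X), reassoc_of% @pr_lin, pr_map]
      change _ = _ ≫ (λ_ M.X).hom ▷ X.X ≫ _
      simp)

theorem tensFun_map {M N : RightMod A} (X : Bimod A B) (f : M ⟶ N) : (tensFun X).F.map f = tensMap f X := rfl
theorem tensFun_μ (X : Bimod A B) (c : C) (M : RightMod A) : μₗ (tensFun X).F c M = (tensLin c M X).hom := rfl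

abbrev tensBi (X : Bimod A B) (Y : Bimod B D) : Bimod A D := X.tensorBimod Y

def prB (X : Bimod A B) (Y : Bimod B D) : X.X ⊗ Y.X ⟶ (tensBi X Y).X :=
  coequalizer.π (X.actRight ▷ Y.X) ((α_ _ _ _).hom ≫ X.X ◁ Y.actLeft)

theorem prB_cond (X : Bimod A B) (Y : Bimod B D) : X.actRight ▷ Y.X ≫ prB X Y =
    (α_ X.X B.X Y.X).hom ≫ X.X ◁ Y.actLeft ≫ prB X Y := by
  have := coequalizer.condition (X.actRight ▷ Y.X) ((α_ X.X B.X Y.X).hom ≫ X.X ◁ Y.actLeft)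
  rw [Category.assoc] at this
  exact this

instance (X : Bimod A B) (Y : Bimod B D) : Epi (prB X Y) :=
  coequalizer.π_epi
instance (X : Bimod A B) (Y : Bimod B D) (c : C) : Epi (c ◁ prB X Y) :=
  inferInstanceAs (Epi ((tensorLeft c).map (prB X Y)))
instance (X : Bimod A B) (Y : Bimod B D) (c : C) : Epi (prB X Y ▷ c) :=
  inferInstanceAs (Epi ((tensorRight c).map (prB X Y)))

theorem prB_actLeft (X : Bimod A B) (Y : Bimod B D) : A.X ◁ prB X Y ≫ (tensBi X Y).actLeft =
    (α_ _ _ _).inv ≫ X.actLeft ▷ Y.X ≫ prB X Y :=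
  Bimod.TensorBimod.whiskerLeft_π_actLeft X Y

theorem prB_actRight (X : Bimod A B) (Y : Bimod B D) : prB X Y ▷ D.X ≫ (tensBi X Y).actRight =
    (α_ _ _ _).hom ≫ X.X ◁ Y.actRight ≫ prB X Y :=
  Bimod.TensorBimod.π_tensor_id_actRight X Y

def descB (c : C) (X : Bimod A B) (Y : Bimod B D) {W : C} (h : c ⊗ X.X ⊗ Y.X ⟶ W)
    (wh : c ◁ X.actRight ▷ Y.X ≫ h =
      c ◁ (α_ X.X B.X Y.X).hom ≫ c ◁ X.X ◁ Y.actLeft ≫ h) : c ⊗ (tensBi X Y).X ⟶ W :=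
  (PreservesCoequalizer.iso (tensorLeft c) _ _).inv ≫ coequalizer.desc h (by simpa using wh)

theorem pr_descB (c : C) (X : Bimod A B) (Y : Bimod B D) {W : C} (h : c ⊗ X.X ⊗ Y.X ⟶ W)
    (wh : c ◁ X.actRight ▷ Y.X ≫ h =
      c ◁ (α_ X.X B.X Y.X).hom ≫ c ◁ X.X ◁ Y.actLeft ≫ h) :
    c ◁ prB X Y ≫ descB c X Y h wh = h :=
  id_tensor_π_preserves_coequalizer_inv_desc _ _ _ _

def assocAux (M : RightMod A) (X : Bimod A B) (Y : Bimod B D) :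
    tens M X ⊗ Y.X ⟶ tens M (tensBi X Y) :=
  descR Y.X M X ((α_ _ _ _).hom ≫ M.X ◁ prB X Y ≫ pr M (tensBi X Y)) (by
    rw [associator_naturality_left_assoc, ← whisker_exchange_assoc, pr_cond,
      associator_naturality_right_assoc, ← MonoidalCategory.whiskerLeft_comp_assoc M.X,
      prB_actLeft]
    simp)

theorem pr_assocAux (M : RightMod A) (X : Bimod A B) (Y : Bimod B D) :
    pr M X ▷ Y.X ≫ assocAux M X Y =
      (α_ _ _ _).hom ≫ M.X ◁ prB X Y ≫ pr M (tensBi X Y) :=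
  pr_descR _ _ _ _ _

def assocHom (M : RightMod A) (X : Bimod A B) (Y : Bimod B D) :
    tens (tensMod M X) Y ⟶ tens M (tensBi X Y) :=
  desc (tensMod M X) Y (assocAux M X Y) (by
    rw [← cancel_epi (pr M X ▷ B.X ▷ Y.X), ← comp_whiskerRight_assoc, pr_act,
      comp_whiskerRight_assoc, comp_whiskerRight_assoc, pr_assocAux,
      associator_naturality_left_assoc, ← whisker_exchange_assoc, pr_assocAux,
      associator_naturality_right_assoc, associator_naturality_middle_assoc,
      ← MonoidalCategory.whiskerLeft_comp_assoc, prB_cond]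
    simp)

theorem pr_assocHom (M : RightMod A) (X : Bimod A B) (Y : Bimod B D) :
    pr (tensMod M X) Y ≫ assocHom M X Y = assocAux M X Y :=
  pr_desc _ _ _ _

theorem pr_pr_assocHom (M : RightMod A) (X : Bimod A B) (Y : Bimod B D) :
    pr M X ▷ Y.X ≫ pr (tensMod M X) Y ≫ assocHom M X Y =
      (α_ _ _ _).hom ≫ M.X ◁ prB X Y ≫ pr M (tensBi X Y) := by
  rw [pr_assocHom, pr_assocAux]

theorem pr_mid (M : RightMod A) (X : Bimod A B) (Y : Bimod B D) :
    M.X ◁ X.actRight ▷ Y.X ≫ (α_ _ _ _).inv ≫ pr M X ▷ Y.X ≫ pr (tensMod M X) Y =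
      M.X ◁ (α_ X.X B.X Y.X).hom ≫ M.X ◁ X.X ◁ Y.actLeft ≫
        (α_ _ _ _).inv ≫ pr M X ▷ Y.X ≫ pr (tensMod M X) Y := by
  have h := pr_cond (tensMod M X) Y
  rw [← cancel_epi (pr M X ▷ B.X ▷ Y.X), ← comp_whiskerRight_assoc, pr_act,
    associator_naturality_left_assoc, ← whisker_exchange_assoc] at h
  rw [← cancel_epi ((α_ M.X X.X B.X).hom ▷ Y.X ≫ (α_ M.X (X.X ⊗ B.X) Y.X).hom)]
  simpa using h

def assocAuxInv (M : RightMod A) (X : Bimod A B) (Y : Bimod B D) :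
    M.X ⊗ (tensBi X Y).X ⟶ tens (tensMod M X) Y :=
  descB M.X X Y ((α_ _ _ _).inv ≫ pr M X ▷ Y.X ≫ pr (tensMod M X) Y) (pr_mid M X Y)

theorem pr_assocAuxInv (M : RightMod A) (X : Bimod A B) (Y : Bimod B D) :
    M.X ◁ prB X Y ≫ assocAuxInv M X Y =
      (α_ _ _ _).inv ≫ pr M X ▷ Y.X ≫ pr (tensMod M X) Y :=
  pr_descB _ _ _ _ _

instance (X : Bimod A B) (Y : Bimod B D) (c d : C) : Epi (c ◁ d ◁ prB X Y) :=
  inferInstanceAs (Epi ((tensorLeft c).map ((tensorLeft d).map (prB X Y))))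

def assocInv (M : RightMod A) (X : Bimod A B) (Y : Bimod B D) :
    tens M (tensBi X Y) ⟶ tens (tensMod M X) Y :=
  desc M (tensBi X Y) (assocAuxInv M X Y) (by
    rw [← cancel_epi ((M.X ⊗ A.X) ◁ prB X Y), whisker_exchange_assoc, pr_assocAuxInv,
      associator_naturality_right_assoc, ← MonoidalCategory.whiskerLeft_comp_assoc, prB_actLeft,
      MonoidalCategory.whiskerLeft_comp_assoc, MonoidalCategory.whiskerLeft_comp_assoc,
      pr_assocAuxInv, associator_inv_naturality_middle_assoc, ← comp_whiskerRight_assoc,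
      associator_inv_naturality_left_assoc, ← comp_whiskerRight_assoc, pr_cond]
    simp)

theorem pr_pr_assocInv (M : RightMod A) (X : Bimod A B) (Y : Bimod B D) :
    M.X ◁ prB X Y ≫ pr M (tensBi X Y) ≫ assocInv M X Y =
      (α_ _ _ _).inv ≫ pr M X ▷ Y.X ≫ pr (tensMod M X) Y := by
  rw [assocInv, pr_desc, pr_assocAuxInv]

def assocCIso (M : RightMod A) (X : Bimod A B) (Y : Bimod B D) :
    tens (tensMod M X) Y ≅ tens M (tensBi X Y) where
  hom := assocHom M X Y
  inv := assocInv M X Y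
  hom_inv_id := by
    rw [← cancel_epi (pr (tensMod M X) Y), ← cancel_epi (pr M X ▷ Y.X),
      reassoc_of% pr_pr_assocHom, pr_pr_assocInv]
    simp
  inv_hom_id := by
    rw [← cancel_epi (pr M (tensBi X Y)), ← cancel_epi (M.X ◁ prB X Y),
      reassoc_of% pr_pr_assocInv, pr_pr_assocHom]
    simp

def assocModIso (M : RightMod A) (X : Bimod A B) (Y : Bimod B D) :
    tensMod (tensMod M X) Y ≅ tensMod M (tensBi X Y) :=
  isoMk (assocCIso M X Y) (by
    change _ ≫ assocHom M X Y = assocHom M X Y ▷ D.X ≫ _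
    rw [← cancel_epi (pr (tensMod M X) Y ▷ D.X), reassoc_of% pr_act,
      ← cancel_epi (pr M X ▷ Y.X ▷ D.X), associator_naturality_left_assoc,
      ← whisker_exchange_assoc, pr_pr_assocHom, ← comp_whiskerRight_assoc,
      ← comp_whiskerRight_assoc, Category.assoc, pr_pr_assocHom,
      comp_whiskerRight_assoc, comp_whiskerRight_assoc, pr_act,
      associator_naturality_middle_assoc, ← MonoidalCategory.whiskerLeft_comp_assoc, prB_actRight]
    simp)

theorem pr_pr_assocMod (M : RightMod A) (X : Bimod A B) (Y : Bimod B D) :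
    pr M X ▷ Y.X ≫ pr (tensMod M X) Y ≫ (assocModIso M X Y).hom.hom =
      (α_ _ _ _).hom ≫ M.X ◁ prB X Y ≫ pr M (tensBi X Y) :=
  pr_pr_assocHom M X Y

theorem assoc_naturality {M N : RightMod A} (f : M ⟶ N) (X : Bimod A B) (Y : Bimod B D) :
    tensMap (tensMap f X) Y ≫ (assocModIso N X Y).hom =
      (assocModIso M X Y).hom ≫ tensMap f (tensBi X Y) := by
  ext
  rw [← cancel_epi (pr M X ▷ Y.X), comp_hom, comp_hom, reassoc_of% pr_map,
    reassoc_of% pr_pr_assocMod, pr_map, ← comp_whiskerRight_assoc, pr_map,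
    comp_whiskerRight_assoc, pr_pr_assocMod]
  simp [whisker_exchange_assoc]

instance (M : RightMod A) (X : Bimod A B) (c d : C) : Epi (c ◁ pr M X ▷ d) :=
  inferInstanceAs (Epi ((tensorLeft c).map ((tensorRight d).map (pr M X))))

theorem assoc_linear (c : C) (M : RightMod A) (X : Bimod A B) (Y : Bimod B D) :
    ((tensLin c (tensMod M X) Y).hom ≫ tensMap (tensLin c M X).hom Y) ≫
        (assocModIso (c ⊙ₗ M) X Y).hom =
      c ⊴ₗ (assocModIso M X Y).hom ≫ (tensLin c M (tensBi X Y)).hom := by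
  ext
  change ((tensLin c (tensMod M X) Y).hom.hom ≫ (tensMap (tensLin c M X).hom Y).hom) ≫
        (assocModIso (c ⊙ₗ M) X Y).hom.hom =
      c ◁ (assocModIso M X Y).hom.hom ≫ (tensLin c M (tensBi X Y)).hom.hom
  rw [← cancel_epi (c ◁ pr (tensMod M X) Y), Category.assoc, reassoc_of% pr_lin,
    reassoc_of% pr_map, ← cancel_epi (c ◁ pr M X ▷ Y.X),
    ← MonoidalCategory.whiskerLeft_comp_assoc,
    ← MonoidalCategory.whiskerLeft_comp_assoc, Category.assoc, pr_pr_assocMod,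
    MonoidalCategory.whiskerLeft_comp_assoc, MonoidalCategory.whiskerLeft_comp_assoc, pr_lin,
    associator_inv_naturality_middle_assoc, ← comp_whiskerRight_assoc, pr_lin,
    comp_whiskerRight_assoc, pr_pr_assocMod]
  change _ ≫ _ ≫ (α_ (c ⊗ M.X) X.X Y.X).hom ≫ (c ⊗ M.X) ◁ prB X Y ≫ _ = _
  simp

/-- The canonical isomorphism `(- ⊗_A X) ⊗_B Y ≅ - ⊗_A (X ⊗_B Y)` of module functors. -/
def assocIso (X : Bimod A B) (Y : Bimod B D) :
    (tensFun X).comp (tensFun Y) ≅ tensFun (tensBi X Y) :=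
  ModFun.isoMk (NatIso.ofComponents (fun M => assocModIso M X Y)
    (fun f => assoc_naturality f X Y)) (fun c M => by
      rw [ModFun.comp_μ]
      exact assoc_linear c M X Y)
end
end RightMod

namespace CenterLin
section
variable {C : Type u} [Category.{v} C] [MonoidalCategory C] [Preadditive C] [MonoidalPreadditive C]

instance (Z W : Center C) : Add (Z ⟶ W) :=
  ⟨fun f g => ⟨f.f + g.f, fun U => by simp [MonoidalPreadditive.add_whiskerRight]⟩⟩
instance (Z W : Center C) : Zero (Z ⟶ W) := ⟨⟨0, fun U => by simp⟩⟩
instance (Z W : Center C) : Neg (Z ⟶ W) :=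
  ⟨fun f => ⟨-f.f, fun U => by
    have h : (-f.f) ▷ U = -(f.f ▷ U) := (tensorRight U).map_neg
    have h' : U ◁ (-f.f) = -(U ◁ f.f) := (tensorLeft U).map_neg
    simp [h, h']⟩⟩

theorem add_f {Z W : Center C} (f g : Z ⟶ W) : (f + g).f = f.f + g.f := rfl
theorem zero_f (Z W : Center C) : (0 : Z ⟶ W).f = 0 := rfl
theorem neg_f {Z W : Center C} (f : Z ⟶ W) : (-f).f = -f.f := rfl

instance (Z W : Center C) : AddCommGroup (Z ⟶ W) where
  add_assoc f g h := Center.ext _ _ (add_assoc f.f g.f h.f)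
  zero_add f := Center.ext _ _ (zero_add f.f)
  add_zero f := Center.ext _ _ (add_zero f.f)
  nsmul := nsmulRec
  zsmul := zsmulRec
  neg_add_cancel f := Center.ext _ _ (neg_add_cancel f.f)
  add_comm f g := Center.ext _ _ (add_comm f.f g.f)

instance : Preadditive (Center C) where
  homGroup := inferInstance
  add_comp _ _ _ f g h := Center.ext _ _ (Preadditive.add_comp _ _ _ f.f g.f h.f)
  comp_add _ _ _ f g h := Center.ext _ _ (Preadditive.comp_add _ _ _ f.f g.f h.f)

def fHom (Z W : Center C) : (Z ⟶ W) →+ (Z.1 ⟶ W.1) where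
  toFun f := f.f
  map_zero' := rfl
  map_add' _ _ := rfl

theorem sum_f {Z W : Center C} {ι : Type*} (s : Finset ι) (f : ι → (Z ⟶ W)) :
    (∑ i ∈ s, f i).f = ∑ i ∈ s, (f i).f := map_sum (fHom Z W) f s

variable (k : Type w) [Field k] [Linear k C] [MonoidalLinear k C]

instance (Z W : Center C) : SMul k (Z ⟶ W) :=
  ⟨fun c f => ⟨c • f.f, fun U => by simp⟩⟩

theorem smul_f {Z W : Center C} (c : k) (f : Z ⟶ W) : (c • f).f = c • f.f := rfl

instance : Linear k (Center C) where
  homModule _ _ :=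
    { one_smul f := Center.ext _ _ (one_smul k f.f)
      mul_smul a b f := Center.ext _ _ (mul_smul a b f.f)
      smul_zero a := Center.ext _ _ (smul_zero a)
      smul_add a f g := Center.ext _ _ (smul_add a f.f g.f)
      add_smul a b f := Center.ext _ _ (add_smul a b f.f)
      zero_smul f := Center.ext _ _ (zero_smul k f.f) }
  smul_comp _ _ _ a f g := Center.ext _ _ (Linear.smul_comp _ _ _ a f.f g.f)
  comp_smul _ _ _ f a g := Center.ext _ _ (Linear.comp_smul _ _ _ f.f a g.f)
end

section
variable {C : Type u} [Category.{v} C] [MonoidalCategory C] [Preadditive C] [MonoidalPreadditive C]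
  [HasFiniteBiproducts C] {J : Type} [Finite J]

def sumβ (X : J → C) (b : ∀ j, HalfBraiding (X j)) (U : C) : (⨁ X) ⊗ U ≅ U ⊗ (⨁ X) :=
  rightDistributor X U ≪≫ biproduct.mapIso (fun j => (b j).β U) ≪≫ (leftDistributor U X).symm

theorem ι_sumβ (X : J → C) (b : ∀ j, HalfBraiding (X j)) (U : C) (j : J) :
    biproduct.ι X j ▷ U ≫ (sumβ X b U).hom = ((b j).β U).hom ≫ U ◁ biproduct.ι X j := by
  simp [sumβ]

theorem sumβ_π (X : J → C) (b : ∀ j, HalfBraiding (X j)) (U : C) (j : J) :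
    (sumβ X b U).hom ≫ U ◁ biproduct.π X j = biproduct.π X j ▷ U ≫ ((b j).β U).hom := by
  simp [sumβ]

/-- The half-braiding on a finite direct sum. -/
def sumHalf (X : J → C) (b : ∀ j, HalfBraiding (X j)) : HalfBraiding (⨁ X) where
  β := sumβ X b
  monoidal U V := by
    apply rightDistributor_ext_left
    intro j
    rw [ι_sumβ, HalfBraiding.monoidal]
    have h1 : biproduct.ι X j ▷ (U ⊗ V) ≫ (α_ _ _ _).inv =
      (α_ _ _ _).inv ≫ biproduct.ι X j ▷ U ▷ V := by simp
    rw [reassoc_of% h1, ← comp_whiskerRight_assoc, ι_sumβ, comp_whiskerRight_assoc,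
      associator_naturality_middle_assoc, ← MonoidalCategory.whiskerLeft_comp_assoc, ι_sumβ]
    simp
  naturality {U V} f := by
    apply rightDistributor_ext_left
    intro j
    rw [← whisker_exchange_assoc, ι_sumβ, reassoc_of% (ι_sumβ X b U j),
      HalfBraiding.naturality_assoc, whisker_exchange]

def sumObj (Z : J → Center C) : Center C := ⟨⨁ fun j => (Z j).1, sumHalf _ fun j => (Z j).2⟩

def sumι (Z : J → Center C) (j : J) : Z j ⟶ sumObj Z :=
  ⟨biproduct.ι (fun j => (Z j).1) j, fun U =>
    ι_sumβ (fun j => (Z j).1) (fun j => (Z j).2) U j⟩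

def sumπ (Z : J → Center C) (j : J) : sumObj Z ⟶ Z j :=
  ⟨biproduct.π (fun j => (Z j).1) j, fun U =>
    (sumβ_π (fun j => (Z j).1) (fun j => (Z j).2) U j).symm⟩

theorem sum_total [Fintype J] (Z : J → Center C) :
    ∑ j, sumπ Z j ≫ sumι Z j = 𝟙 (sumObj Z) := by
  apply Center.ext
  rw [sum_f]
  exact biproduct.total (f := fun j => (Z j).1)

theorem sumι_π_self (Z : J → Center C) (j : J) : sumι Z j ≫ sumπ Z j = 𝟙 (Z j) :=
  Center.ext _ _ (biproduct.ι_π_self (fun j => (Z j).1) j)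

theorem sumι_π_ne (Z : J → Center C) {i j : J} (h : i ≠ j) : sumι Z i ≫ sumπ Z j = 0 :=
  Center.ext _ _ (biproduct.ι_π_ne (fun j => (Z j).1) h)

def sumBicone (Z : J → Center C) : Bicone Z := by
  classical
  exact
  { pt := sumObj Z
    π := sumπ Z
    ι := sumι Z
    ι_π := fun i j => by
      by_cases h : i = j
      · subst h; simpa using sumι_π_self Z i
      · simpa [h] using sumι_π_ne Z h }

end

instance {C : Type u} [Category.{v} C] [MonoidalCategory C] [Preadditive C]
    [MonoidalPreadditive C] [HasFiniteBiproducts C] : HasFiniteBiproducts (Center C) where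
  out n :=
    { has_biproduct := fun Z => HasBiproduct.mk
        { bicone := sumBicone Z
          isBilimit := isBilimitOfTotal _ (sum_total Z) } }
end CenterLin

/-- The tensor product over `k` of two `k`-linear categories: objects are pairs of objects, and
morphism spaces are tensor products of morphism spaces. -/
structure TensorCat (k : Type w) [Field k] (C : Type u) [Category.{v} C] [Preadditive C] [Linear k C]
    (D : Type u₁) [Category.{v₁} D] [Preadditive D] [Linear k D] : Type (max u v u₁ v₁) where
  fst : C
  snd : D

namespace TensorCat
open scoped TensorProduct
section
variable {k : Type w} [Field k] {C : Type u} [Category.{v} C] [Preadditive C] [Linear k C]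
    {D : Type u₁} [Category.{v₁} D] [Preadditive D] [Linear k D]

def compMap (a b c : TensorCat k C D) :
    ((a.fst ⟶ b.fst) ⊗[k] (a.snd ⟶ b.snd)) →ₗ[k] ((b.fst ⟶ c.fst) ⊗[k] (b.snd ⟶ c.snd)) →ₗ[k]
      ((a.fst ⟶ c.fst) ⊗[k] (a.snd ⟶ c.snd)) :=
  TensorProduct.map₂ (Linear.comp a.fst b.fst c.fst) (Linear.comp a.snd b.snd c.snd)

instance : Category (TensorCat k C D) where
  Hom a b := (a.fst ⟶ b.fst) ⊗[k] (a.snd ⟶ b.snd)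
  id a := 𝟙 a.fst ⊗ₜ 𝟙 a.snd
  comp {a b c} s t := compMap a b c s t
  id_comp {a b} t := by
    refine TensorProduct.induction_on t ?_ ?_ ?_
    · simp
    · intro f g; simp [compMap]
    · intro s t hs ht; rw [map_add, hs, ht]
  comp_id {a b} t := by
    refine TensorProduct.induction_on t ?_ ?_ ?_
    · simp
    · intro f g; simp [compMap]
    · intro s t hs ht; rw [map_add, LinearMap.add_apply, hs, ht]
  assoc {a b c d} r s t := by
    refine TensorProduct.induction_on r (by simp) ?_ ?_
    · intro f g
      refine TensorProduct.induction_on s (by simp) ?_ ?_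
      · intro f' g'
        refine TensorProduct.induction_on t (by simp) ?_ ?_
        · intro f'' g''; simp [compMap]
        · intro x y hx hy
          simp only [map_add, hx, hy]
      · intro x y hx hy
        simp only [map_add, LinearMap.add_apply, hx, hy]
    · intro x y hx hy
      simp only [map_add, LinearMap.add_apply, hx, hy]

instance : Preadditive (TensorCat k C D) where
  homGroup a b := inferInstanceAs (AddCommGroup ((a.fst ⟶ b.fst) ⊗[k] (a.snd ⟶ b.snd)))
  add_comp a b c r s t := by
    have h : ∀ r s : (a.fst ⟶ b.fst) ⊗[k] (a.snd ⟶ b.snd),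
        compMap a b c (r + s) t = compMap a b c r t + compMap a b c s t := by
      intro r s
      rw [map_add, LinearMap.add_apply]
    exact h r s
  comp_add a b c r s t := by
    have h : ∀ s t : (b.fst ⟶ c.fst) ⊗[k] (b.snd ⟶ c.snd),
        compMap a b c r (s + t) = compMap a b c r s + compMap a b c r t := by
      intro s t
      rw [map_add]
    exact h s t

end

section
variable (k : Type w) [Field k] (C : Type u) [Category.{v} C] [Preadditive C] [Linear k C]
  [MonoidalCategory C] [MonoidalPreadditive C] [MonoidalLinear k C] [BraidedCategory C]

/-- The object `a ⊗ b` of the Drinfeld center, with half-braiding given on `a` by the reverse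
(inverse) braiding and on `b` by the braiding. -/
def gcObj (a b : C) : Center C :=
  @Center.ofBraidedObj C _ _ (reverseBraiding C) a ⊗ Center.ofBraidedObj b

def gcPure {a b a' b' : C} (f : a ⟶ a') (g : b ⟶ b') : gcObj C a b ⟶ gcObj C a' b' :=
  (@Center.ofBraided C _ _ (reverseBraiding C)).map f ⊗ₘ (Center.ofBraided C).map g

theorem gcPure_f {a b a' b' : C} (f : a ⟶ a') (g : b ⟶ b') : (gcPure C f g).f = f ⊗ₘ g := rfl

def gcMap (a b a' b' : C) :
    ((a ⟶ a') ⊗[k] (b ⟶ b')) →ₗ[k] (gcObj C a b ⟶ gcObj C a' b') :=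
  TensorProduct.lift (LinearMap.mk₂ k (fun f g => gcPure C f g)
    (fun f f' g => Center.ext _ _ (MonoidalPreadditive.add_tensor f f' g))
    (fun c f g => Center.ext _ _ (by
      change (c • f) ⊗ₘ g = c • (f ⊗ₘ g)
      simp [MonoidalCategory.tensorHom_def]))
    (fun f g g' => Center.ext _ _ (MonoidalPreadditive.tensor_add f g g'))
    (fun c f g => Center.ext _ _ (by
      change f ⊗ₘ (c • g) = c • (f ⊗ₘ g)
      simp [MonoidalCategory.tensorHom_def])))

theorem gcMap_tmul {a b a' b' : C} (f : a ⟶ a') (g : b ⟶ b') :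
    gcMap k C a b a' b' (f ⊗ₜ g) = gcPure C f g := rfl

theorem gcMap_comp (a b c : TensorCat k C C) (s : (a.fst ⟶ b.fst) ⊗[k] (a.snd ⟶ b.snd))
    (t : (b.fst ⟶ c.fst) ⊗[k] (b.snd ⟶ c.snd)) :
    gcMap k C _ _ _ _ (compMap a b c s t) = gcMap k C _ _ _ _ s ≫ gcMap k C _ _ _ _ t := by
  refine TensorProduct.induction_on s (by simp) ?_ ?_
  · intro f g
    refine TensorProduct.induction_on t (by simp) ?_ ?_
    · intro f' g'
      apply Center.ext
      change (f ≫ f') ⊗ₘ (g ≫ g') = (f ⊗ₘ g) ≫ (f' ⊗ₘ g')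
      simp
    · intro x y hx hy
      simp only [map_add, hx, hy, Preadditive.comp_add]
  · intro x y hx hy
    simp only [map_add, LinearMap.add_apply, hx, hy, Preadditive.add_comp]

/-- The functor `(a, b) ↦ a ⊗ b` to the Drinfeld center. -/
def gcPre : TensorCat k C C ⥤ Center C where
  obj a := gcObj C a.fst a.snd
  map {a b} t := gcMap k C a.fst a.snd b.fst b.snd t
  map_id a := Center.ext _ _ (MonoidalCategory.id_tensorHom_id a.fst a.snd)
  map_comp {a b c} s t := gcMap_comp k C a b c s t

instance : (gcPre k C).Additive where
  map_add {a b} s t := map_add (gcMap k C a.fst a.snd b.fst b.snd) s t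

end
end TensorCat

/-- The Deligne product of finitely semisimple categories over an algebraically closed field,
obtained from the tensor product of linear categories by adjoining finite direct sums (which for
such categories already gives a semisimple abelian category, with simple objects the pairs of
simple objects). -/
abbrev DeligneProd (k : Type w) [Field k] (C : Type u) [Category.{v} C] [Preadditive C] [Linear k C]
    (D : Type u₁) [Category.{v₁} D] [Preadditive D] [Linear k D] :=
  Mat_ (TensorCat k C D)

/-- The canonical functor from the Deligne product of `C` with reversed braiding and `C` to the
Drinfeld center of `C`. -/
def functorGC (k : Type w) [Field k] (C : Type u) [Category.{v} C] [Preadditive C] [Linear k C]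
    [HasFiniteBiproducts C] [MonoidalCategory C] [MonoidalPreadditive C] [MonoidalLinear k C]
    [BraidedCategory C] : DeligneProd k C C ⥤ Center C :=
  Mat_.lift (TensorCat.gcPre k C)

/-- Fusion categories: `k`-linear rigid monoidal categories with simple unit and
finite-dimensional morphism spaces that are finitely semisimple, i.e. there are finitely many
simple objects up to isomorphism and each object is a finite direct sum of simple objects. -/
class FusionCategory (k : Type w) [Field k] (C : Type u) [Category.{v} C] [MonoidalCategory C]
    [Abelian C] [Linear k C] [MonoidalPreadditive C] [MonoidalLinear k C] [RigidCategory C] :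
    Prop where
  simple_unit : Simple (𝟙_ C)
  finite_hom (X Y : C) : FiniteDimensional k (X ⟶ Y)
  finite_simples : ∃ (n : ℕ) (S : Fin n → C), (∀ i, Simple (S i)) ∧
    (∀ i j, Nonempty (S i ≅ S j) → i = j) ∧ ∀ X : C, Simple X → ∃ i, Nonempty (X ≅ S i)
  semisimple (X : C) : ∃ (n : ℕ) (S : Fin n → C), (∀ i, Simple (S i)) ∧ Nonempty (X ≅ ⨁ S)

attribute [instance] FusionCategory.finite_hom

/-- The braiding is modular if the canonical functor from the Deligne product of the reverse of
`C` with `C` to the Drinfeld center is an equivalence. -/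
class ModularBraiding (k : Type w) [Field k] (C : Type u) [Category.{v} C] [MonoidalCategory C]
    [Abelian C] [Linear k C] [MonoidalPreadditive C] [MonoidalLinear k C] [BraidedCategory C] :
    Prop where
  isEquivalence : (functorGC k C).IsEquivalence

namespace CenterRep
open TensorCat CenterLin
section
variable {k : Type w} [Field k] {C : Type u} [Category.{v} C] [MonoidalCategory C]
    [Abelian C] [Linear k C] [MonoidalPreadditive C] [MonoidalLinear k C]

theorem hom_zero_or_smul [IsAlgClosed k] [∀ X Y : C, FiniteDimensional k (X ⟶ Y)] {n : ℕ}
    {S : Fin n → C} (hS : ∀ i, Simple (S i))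
    (hne : ∀ i j, Nonempty (S i ≅ S j) → i = j) {i j : Fin n} (h : i ≠ j) (f : S i ⟶ S j) :
    f = 0 := by
  have := hS i
  have := hS j
  by_contra h0
  have := isIso_of_hom_simple h0
  exact h (hne i j ⟨asIso f⟩)

variable [BraidedCategory C]

theorem gc_full [ModularBraiding k C] : (gcPre k C).Full := by
  have := ModularBraiding.isEquivalence (k := k) (C := C)
  have : (Mat_.lift (gcPre k C)).Full :=
    (inferInstance : (functorGC k C).Full)
  exact Functor.Full.of_iso (Mat_.embeddingLiftIso (gcPre k C))

theorem gc_hom_ne [IsAlgClosed k] [∀ X Y : C, FiniteDimensional k (X ⟶ Y)] [ModularBraiding k C]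
    {n : ℕ} {S : Fin n → C} (hS : ∀ i, Simple (S i))
    (hne : ∀ i j, Nonempty (S i ≅ S j) → i = j) {s t : Fin n × Fin n} (h : s ≠ t)
    (f : gcObj C (S s.1) (S s.2) ⟶ gcObj C (S t.1) (S t.2)) : f = 0 := by
  have := gc_full (k := k) (C := C)
  obtain ⟨r, rfl⟩ := (gcPre k C).map_surjective (X := TensorCat.mk (S s.1) (S s.2))
    (Y := TensorCat.mk (S t.1) (S t.2)) f
  change gcMap k C _ _ _ _ r = 0
  refine TensorProduct.induction_on r (map_zero _) ?_ ?_
  · intro f g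
    have : f = 0 ∨ g = 0 := by
      by_cases h1 : s.1 = t.1
      · right
        exact hom_zero_or_smul (k := k) hS hne (fun h2 => h (Prod.ext h1 h2)) g
      · left
        exact hom_zero_or_smul (k := k) hS hne h1 f
    rcases this with rfl | rfl <;> simp
  · intro x y hx hy
    rw [map_add, hx, hy, add_zero]

theorem gc_hom_self [IsAlgClosed k] [∀ X Y : C, FiniteDimensional k (X ⟶ Y)] [ModularBraiding k C]
    {X Y : C} [Simple X] [Simple Y] (f : gcObj C X Y ⟶ gcObj C X Y) : ∃ c : k, f = c • 𝟙 _ := by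
  have := gc_full (k := k) (C := C)
  obtain ⟨r, rfl⟩ := (gcPre k C).map_surjective (X := TensorCat.mk X Y)
    (Y := TensorCat.mk X Y) f
  change ∃ c : k, gcMap k C _ _ _ _ r = c • 𝟙 _
  refine TensorProduct.induction_on r ⟨0, by simp⟩ ?_ ?_
  · intro f g
    obtain ⟨a, rfl⟩ := endomorphism_simple_eq_smul_id k f
    obtain ⟨b, rfl⟩ := endomorphism_simple_eq_smul_id k g
    refine ⟨a * b, ?_⟩
    rw [TensorProduct.smul_tmul_smul, map_smul, gcMap_tmul]
    congr 1
    exact Center.ext _ _ (MonoidalCategory.id_tensorHom_id X Y)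
  · rintro x y ⟨a, hx⟩ ⟨b, hy⟩
    exact ⟨a + b, by rw [map_add, hx, hy, add_smul]⟩

variable {X Y : C}

/-- The property that `u` represents `P` at the object `Z`. -/
def Good (D : Center C) (u : D.1 ⊗ X ⟶ Y) (P : ∀ Z : Center C, Submodule k (Z.1 ⊗ X ⟶ Y))
    (Z : Center C) : Prop :=
  (∀ f : Z ⟶ D, f.f ▷ X ≫ u = 0 → f = 0) ∧ ∀ h ∈ P Z, ∃ f : Z ⟶ D, f.f ▷ X ≫ u = h

theorem good_of_retract (D : Center C) (u : D.1 ⊗ X ⟶ Y)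
    (P : ∀ Z : Center C, Submodule k (Z.1 ⊗ X ⟶ Y))
    (hP : ∀ {Z W : Center C} (f : Z ⟶ W) (h : W.1 ⊗ X ⟶ Y), h ∈ P W → f.f ▷ X ≫ h ∈ P Z)
    (Z : Center C) {T : Type*} [Fintype T] (s : T → Center C) (p : ∀ t, Z ⟶ s t)
    (q : ∀ t, s t ⟶ Z) (hpq : ∑ t, p t ≫ q t = 𝟙 Z) (hs : ∀ t, Good D u P (s t)) :
    Good D u P Z := by
  have key : ∀ h : Z.1 ⊗ X ⟶ Y, ∑ t, (p t).f ▷ X ≫ (q t).f ▷ X ≫ h = h := by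
    intro h
    have := congrArg (fun g => Center.Hom.f g ▷ X ≫ h) hpq
    simp only [sum_f, sum_whiskerRight, Preadditive.sum_comp] at this
    simpa using this
  constructor
  · intro f hf
    have : ∀ t, q t ≫ f = 0 := fun t => (hs t).1 _ (by
      rw [Center.comp_f, comp_whiskerRight, Category.assoc, hf, comp_zero])
    rw [← Category.id_comp f, ← hpq, Preadditive.sum_comp]
    exact Finset.sum_eq_zero fun t _ => by rw [Category.assoc, this, comp_zero]
  · intro h hh
    choose g hg using fun t => (hs t).2 _ (hP (q t) h hh)
    refine ⟨∑ t, p t ≫ g t, ?_⟩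
    rw [sum_f, sum_whiskerRight, Preadditive.sum_comp]
    rw [← key h]
    refine Finset.sum_congr rfl fun t _ => ?_
    rw [Center.comp_f, comp_whiskerRight, Category.assoc, hg]

theorem exists_decomp [RigidCategory C] [FusionCategory k C] {n : ℕ} {S : Fin n → C}
    (hall : ∀ X : C, Simple X → ∃ i, Nonempty (X ≅ S i)) (Z : C) :
    ∃ (m : ℕ) (r : Fin m → Fin n) (p : ∀ l, Z ⟶ S (r l)) (q : ∀ l, S (r l) ⟶ Z),
      ∑ l, p l ≫ q l = 𝟙 Z := by
  obtain ⟨m, s, hs, ⟨e⟩⟩ := FusionCategory.semisimple k Z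
  choose r hr using fun l => hall (s l) (hs l)
  refine ⟨m, r, fun l => e.hom ≫ biproduct.π s l ≫ (hr l).some.hom,
    fun l => (hr l).some.inv ≫ biproduct.ι s l ≫ e.inv, ?_⟩
  have h := biproduct.total (f := s)
  have h2 : e.hom ≫ (∑ l, biproduct.π s l ≫ biproduct.ι s l) ≫ e.inv = 𝟙 Z := by
    rw [h]; simp
  rw [← h2]
  rw [Preadditive.sum_comp, Preadditive.comp_sum]
  simp

theorem exists_rep [IsAlgClosed k] [RigidCategory C] [FusionCategory k C] [ModularBraiding k C]
    (P : ∀ Z : Center C, Submodule k (Z.1 ⊗ X ⟶ Y))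
    (hP : ∀ {Z W : Center C} (f : Z ⟶ W) (h : W.1 ⊗ X ⟶ Y), h ∈ P W → f.f ▷ X ≫ h ∈ P Z) :
    ∃ (D : Center C) (u : D.1 ⊗ X ⟶ Y), u ∈ P D ∧ ∀ Z, Good D u P Z := by
  obtain ⟨n, S, hS, hne, hall⟩ := FusionCategory.finite_simples (k := k) (C := C)
  let s : Fin n × Fin n → Center C := fun t => gcObj C (S t.1) (S t.2)
  let b := fun t => Module.finBasis k (P (s t))
  let J := Σ t : Fin n × Fin n, Fin (Module.finrank k (P (s t)))
  let Zs : J → Center C := fun x => s x.1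
  let e : ∀ x : J, (Zs x).1 ⊗ X ⟶ Y := fun x => (b x.1 x.2 : _)
  have he : ∀ x, e x ∈ P (Zs x) := fun x => (b x.1 x.2).2
  let u : (sumObj Zs).1 ⊗ X ⟶ Y := ∑ x, (sumπ Zs x).f ▷ X ≫ e x
  have hu : ∀ x, (sumι Zs x).f ▷ X ≫ u = e x := by
    intro x
    simp only [u, Preadditive.comp_sum]
    rw [Finset.sum_eq_single x]
    · rw [← comp_whiskerRight_assoc, ← Center.comp_f, sumι_π_self]; simp
    · intro y _ hy
      rw [← comp_whiskerRight_assoc, ← Center.comp_f, sumι_π_ne _ hy.symm, zero_f]; simp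
    · simp
  refine ⟨sumObj Zs, u, Submodule.sum_mem _ fun x _ => hP _ _ (he x), ?_⟩
  have hgood : ∀ t, Good (sumObj Zs) u P (s t) := by
    intro t
    constructor
    · intro f hf
      have h0 : ∀ x : J, x.1 ≠ t → f ≫ sumπ Zs x = 0 := fun x hx =>
        gc_hom_ne (k := k) hS hne (Ne.symm hx) _
      have h1 : ∀ m, ∃ c : k, f ≫ sumπ Zs ⟨t, m⟩ = c • 𝟙 _ := fun m => by
        have := hS t.1
        have := hS t.2
        exact gc_hom_self _
      choose c hc using h1
      have h2 : f.f ▷ X ≫ u = ∑ m, c m • (b t m : (s t).1 ⊗ X ⟶ Y) := by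
        simp only [u, Preadditive.comp_sum]
        rw [Fintype.sum_sigma, Finset.sum_eq_single t]
        · refine Finset.sum_congr rfl fun m _ => ?_
          rw [← comp_whiskerRight_assoc, ← Center.comp_f, hc, smul_f]
          simp [e]
        · intro t' _ ht'
          refine Finset.sum_eq_zero fun m _ => ?_
          rw [← comp_whiskerRight_assoc, ← Center.comp_f, h0 ⟨t', m⟩ ht', zero_f]
          simp
        · simp
      rw [h2] at hf
      have h3 : ∑ m, c m • b t m = 0 := by
        apply Subtype.ext
        simpa using hf
      have h4 := Fintype.linearIndependent_iff.1 (b t).linearIndependent c h3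
      have h5 : ∀ x, f ≫ sumπ Zs x = 0 := by
        rintro ⟨t', m⟩
        by_cases h : t' = t
        · subst h
          rw [hc, h4, zero_smul]
        · exact h0 _ h
      rw [← Category.comp_id f, ← sum_total Zs, Preadditive.comp_sum]
      exact Finset.sum_eq_zero fun x _ => by rw [← Category.assoc, h5, zero_comp]
    · intro h hh
      refine ⟨∑ m, (b t).repr ⟨h, hh⟩ m • sumι Zs ⟨t, m⟩, ?_⟩
      have h1 := congrArg (fun x : P (s t) => (x : (s t).1 ⊗ X ⟶ Y)) ((b t).sum_repr ⟨h, hh⟩)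
      simp only [Submodule.coe_sum, Submodule.coe_smul] at h1
      conv_rhs => rw [← h1]
      rw [sum_f, sum_whiskerRight, Preadditive.sum_comp]
      refine Finset.sum_congr rfl fun m _ => ?_
      rw [smul_f, MonoidalLinear.smul_whiskerRight, Linear.smul_comp, hu]
  have hgc : ∀ A B : C, Good (sumObj Zs) u P (gcObj C A B) := by
    intro A B
    obtain ⟨m, r, p, q, hpq⟩ := exists_decomp (k := k) hall A
    obtain ⟨m', r', p', q', hpq'⟩ := exists_decomp (k := k) hall B
    refine good_of_retract _ u P hP _ (T := Fin m × Fin m') (fun t => s (r t.1, r' t.2))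
      (fun t => gcPure C (p t.1) (p' t.2)) (fun t => gcPure C (q t.1) (q' t.2)) ?_
      (fun t => hgood _)
    apply Center.ext
    rw [sum_f]
    change ∑ t : Fin m × Fin m', (p t.1 ⊗ₘ p' t.2) ≫ (q t.1 ⊗ₘ q' t.2) = 𝟙 (A ⊗ B)
    rw [← MonoidalCategory.id_tensorHom_id, ← hpq, ← hpq', sum_tensor, Fintype.sum_prod_type]
    refine Finset.sum_congr rfl fun l _ => ?_
    rw [tensor_sum]
    simp
  intro Z
  have := ModularBraiding.isEquivalence (k := k) (C := C)
  let M := (functorGC k C).objPreimage Z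
  let i : (functorGC k C).obj M ≅ Z := (functorGC k C).objObjPreimageIso Z
  have hM : Good (sumObj Zs) u P ((functorGC k C).obj M) :=
    good_of_retract _ u P hP _ (fun l => gcObj C (M.X l).fst (M.X l).snd)
      (fun l => biproduct.π (fun l => (gcPre k C).obj (M.X l)) l)
      (fun l => biproduct.ι (fun l => (gcPre k C).obj (M.X l)) l)
      biproduct.total (fun l => hgc _ _)
  exact good_of_retract _ u P hP _ (T := Unit) (fun _ => (functorGC k C).obj M) (fun _ => i.inv)
    (fun _ => i.hom) (by simp) (fun _ => hM)
end
end CenterRep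

namespace ModHom
open CenterRep CenterLin
section
variable {k : Type w} [Field k] {C : Type u} [Category.{v} C] [MonoidalCategory C]
    [Abelian C] [Linear k C] [MonoidalPreadditive C] [MonoidalLinear k C] [RigidCategory C]
    {A B : Mon C}

/-- The regular right module. -/
def regMod (A : Mon C) : RightMod A where
  X := A.X
  act := MonObj.mul
  act_one := MonObj.mul_one A.X
  act_mul := by rw [MonObj.mul_assoc]; simp

def homMk {F G : ModFun C (RightMod A) (RightMod B)} (h : ∀ M, (F.F.obj M).X ⟶ (G.F.obj M).X)
    (h1 : ∀ M, (F.F.obj M).act ≫ h M = h M ▷ B.X ≫ (G.F.obj M).act)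
    (h2 : ∀ {M N : RightMod A} (f : M ⟶ N), (F.F.map f).hom ≫ h N = h M ≫ (G.F.map f).hom)
    (h3 : ∀ (c : C) (M : RightMod A), (μₗ F.F c M).hom ≫ h (c ⊙ₗ M) =
      c ◁ h M ≫ (μₗ G.F c M).hom) : F ⟶ G where
  τ := { app M := ⟨h M, h1 M⟩
         naturality _ _ f := RightMod.hom_ext _ _ (h2 f) }
  comm c M := RightMod.hom_ext _ _ (h3 c M)

theorem hom_nat {F G : ModFun C (RightMod A) (RightMod B)} (φ : F ⟶ G) {M N : RightMod A}
    (f : M ⟶ N) : (F.F.map f).hom ≫ (φ.τ.app N).hom = (φ.τ.app M).hom ≫ (G.F.map f).hom :=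
  congrArg RightMod.Hom.hom (φ.τ.naturality f)

theorem hom_comm {F G : ModFun C (RightMod A) (RightMod B)} (φ : F ⟶ G) (c : C) (M : RightMod A) :
    (μₗ F.F c M).hom ≫ (φ.τ.app (c ⊙ₗ M)).hom = c ◁ (φ.τ.app M).hom ≫ (μₗ G.F c M).hom :=
  congrArg RightMod.Hom.hom (φ.comm c M)

variable (k) in
def homSub (F G : ModFun C (RightMod A) (RightMod B)) (M : RightMod A) :
    Submodule k ((F.F.obj M).X ⟶ (G.F.obj M).X) where
  carrier := {h | ∃ φ : F ⟶ G, (φ.τ.app M).hom = h}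
  zero_mem' := ⟨homMk (fun _ => 0) (by simp) (by simp) (by simp), rfl⟩
  add_mem' := by
    rintro _ _ ⟨φ, rfl⟩ ⟨ψ, rfl⟩
    exact ⟨homMk (fun M => (φ.τ.app M).hom + (ψ.τ.app M).hom)
      (fun M => by simp [RightMod.Hom.comm, MonoidalPreadditive.add_whiskerRight])
      (fun f => by simp [hom_nat])
      (fun c M => by simp [hom_comm, MonoidalPreadditive.whiskerLeft_add]), rfl⟩
  smul_mem' := by
    rintro a _ ⟨φ, rfl⟩
    exact ⟨homMk (fun M => a • (φ.τ.app M).hom)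
      (fun M => by simp [RightMod.Hom.comm])
      (fun f => by simp [hom_nat])
      (fun c M => by simp [hom_comm]), rfl⟩

def actHom (M : RightMod A) : M.X ⊙ₗ regMod A ⟶ M where
  hom := M.act
  comm := by
    change ((α_ _ _ _).hom ≫ M.X ◁ MonObj.mul) ≫ M.act = M.act ▷ A.X ≫ M.act
    rw [Category.assoc, M.act_mul]
    simp

instance (M : RightMod A) : IsSplitEpi M.act :=
  ⟨⟨⟨(ρ_ _).inv ≫ M.X ◁ MonObj.one, by rw [Category.assoc, M.act_one]; simp⟩⟩⟩

theorem epi_act (c : C) (M : RightMod A) (X : Bimod A B) :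
    Epi (c ◁ (RightMod.tensMap (actHom M) X).hom) := by
  have h := RightMod.pr_map (actHom M) X
  have h1 : Epi ((actHom M).hom ▷ X.X ≫ RightMod.pr M X) := by
    have : Epi ((actHom M).hom ▷ X.X) := inferInstanceAs (Epi ((tensorRight X.X).map M.act))
    exact epi_comp _ _
  rw [← h] at h1
  have := epi_of_epi (RightMod.pr (M.X ⊙ₗ regMod A) X) (RightMod.tensMap (actHom M) X).hom
  exact inferInstanceAs (Epi ((tensorLeft c).map (RightMod.tensMap (actHom M) X).hom))

theorem hom_ext_reg (X : Bimod A B) (Z : Center C) (G : ModFun C (RightMod A) (RightMod B))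
    (φ ψ : Z ⊙ₗ RightMod.tensFun X ⟶ G)
    (h : (φ.τ.app (regMod A)).hom = (ψ.τ.app (regMod A)).hom) : φ = ψ := by
  ext M
  have h1 : (φ.τ.app (M.X ⊙ₗ regMod A)).hom = (ψ.τ.app (M.X ⊙ₗ regMod A)).hom := by
    have a := hom_comm φ M.X (regMod A)
    have b := hom_comm ψ M.X (regMod A)
    rw [h, ← b] at a
    have : IsIso (μₗ (Z ⊙ₗ RightMod.tensFun X).F M.X (regMod A)).hom :=
      ⟨⟨(δₗ (Z ⊙ₗ RightMod.tensFun X).F M.X (regMod A)).hom,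
        congrArg RightMod.Hom.hom (μₗ_comp_δₗ (F := (Z ⊙ₗ RightMod.tensFun X).F) M.X (regMod A)),
        congrArg RightMod.Hom.hom (δₗ_comp_μₗ (F := (Z ⊙ₗ RightMod.tensFun X).F) M.X (regMod A))⟩⟩
    exact (cancel_epi _).1 a
  have a := hom_nat φ (actHom M)
  have b := hom_nat ψ (actHom M)
  rw [h1, ← b] at a
  have := epi_act Z.1 M X
  have e : ((Z ⊙ₗ RightMod.tensFun X).F.map (actHom M)).hom =
    Z.1 ◁ (RightMod.tensMap (actHom M) X).hom := rfl
  rw [e] at a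
  exact (cancel_epi (Z.1 ◁ (RightMod.tensMap (actHom M) X).hom)).1 a

theorem exists_internalHom [IsAlgClosed k] [FusionCategory k C] [BraidedCategory C]
    [ModularBraiding k C] (X : Bimod A B) (G : ModFun C (RightMod A) (RightMod B)) :
    Nonempty (InternalHom (Center C) (RightMod.tensFun X) G) := by
  obtain ⟨D, u, ⟨ev, hev⟩, hD⟩ := exists_rep (k := k)
    (X := ((RightMod.tensFun X).F.obj (regMod A)).X) (Y := (G.F.obj (regMod A)).X)
    (fun Z => homSub k (Z ⊙ₗ RightMod.tensFun X) G (regMod A))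
    (by
      rintro Z W f _ ⟨φ, rfl⟩
      exact ⟨f ⊵ₗ RightMod.tensFun X ≫ φ, rfl⟩)
  have key : ∀ (Z : Center C) (φ : Z ⊙ₗ RightMod.tensFun X ⟶ G), ∃ f : Z ⟶ D,
      f ⊵ₗ RightMod.tensFun X ≫ ev = φ := by
    intro Z φ
    obtain ⟨f, hf⟩ := (hD Z).2 _ ⟨φ, rfl⟩
    refine ⟨f, hom_ext_reg X Z G _ _ ?_⟩
    rw [← hf, ← hev]
    rfl
  choose cur hcur using key
  refine ⟨⟨D, ev, fun f => cur _ f, fun f => hcur _ f, ?_⟩⟩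
  intro Z φ f hf
  have h := (hD Z).1 (f - cur Z φ) (by
    have h1 : f.f ▷ _ ≫ u = (cur Z φ).f ▷ _ ≫ u := by
      rw [← hev]
      exact congrArg (fun ψ : Z ⊙ₗ RightMod.tensFun X ⟶ G => (ψ.τ.app (regMod A)).hom)
        (hf.trans (hcur Z φ).symm)
    have h2 : (f - cur Z φ).f = f.f - (cur Z φ).f := by
      rw [sub_eq_add_neg, add_f, neg_f, sub_eq_add_neg]
    rw [h2, sub_eq_add_neg, MonoidalPreadditive.add_whiskerRight, Preadditive.add_comp, h1]
    have h3 : (-(cur Z φ).f) ▷ ((RightMod.tensFun X).F.obj (regMod A)).X =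
      -((cur Z φ).f ▷ ((RightMod.tensFun X).F.obj (regMod A)).X) := (tensorRight _).map_neg
    rw [h3, Preadditive.neg_comp, add_neg_cancel])
  exact sub_eq_zero.1 h
end
end ModHom

/-- A pivotal structure: a monoidal natural isomorphism from the identity to the double right
dual. The third field compares `π (X ⊗ Y)` with `π X ⊗ π Y` along the canonical isomorphism
`(X ⊗ Y)ᘁᘁ ≅ (Xᘁ)ᘁ ⊗ (Yᘁ)ᘁ`. -/
class PivotalCategory (C : Type u) [Category.{v} C] [MonoidalCategory C] [RigidCategory C] where
  π (X : C) : X ≅ (Xᘁ)ᘁ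
  natural {X Y : C} (f : X ⟶ Y) : f ≫ (π Y).hom = (π X).hom ≫ (fᘁ)ᘁ
  monoidal (X Y : C) : (π (X ⊗ Y)).hom ≫ ((rightDualTensorIso X Y).inv)ᘁ ≫
    (rightDualTensorIso Yᘁ Xᘁ).hom = (π X).hom ⊗ₘ (π Y).hom

namespace PivotalCategory
section
variable {C : Type u} [Category.{v} C] [MonoidalCategory C] [RigidCategory C] [PivotalCategory C]

/-- The right trace of an endomorphism. -/
def trR {X : C} (f : X ⟶ X) : 𝟙_ C ⟶ 𝟙_ C :=
  η_ X Xᘁ ≫ (f ≫ (π X).hom) ▷ Xᘁ ≫ ε_ Xᘁ (Xᘁ)ᘁ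

/-- The left coevaluation of `X`. -/
def coevL (X : C) : 𝟙_ C ⟶ Xᘁ ⊗ X :=
  η_ Xᘁ (Xᘁ)ᘁ ≫ Xᘁ ◁ (π X).inv

/-- The left trace of an endomorphism. -/
def trL {X : C} (f : X ⟶ X) : 𝟙_ C ⟶ 𝟙_ C :=
  coevL X ≫ Xᘁ ◁ f ≫ ε_ X Xᘁ

/-- The dimension of an object, as an endomorphism of the unit. -/
def dim (X : C) : 𝟙_ C ⟶ 𝟙_ C := trR (𝟙 X)

end
end PivotalCategory

/-- A pivotal structure is spherical if left and right traces agree. -/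
class SphericalCategory (C : Type u) [Category.{v} C] [MonoidalCategory C] [RigidCategory C]
    [PivotalCategory C] : Prop where
  trR_eq_trL {X : C} (f : X ⟶ X) : PivotalCategory.trR f = PivotalCategory.trL f

/-- A Frobenius algebra: an algebra and coalgebra with the two Frobenius relations. -/
structure FrobeniusAlgebra (C : Type u) [Category.{v} C] [MonoidalCategory C] where
  alg : Mon C
  coalg : ComonObj alg.X
  frobenius_left : alg.X ◁ coalg.comul ≫ (α_ _ _ _).inv ≫ MonObj.mul ▷ alg.X =
    MonObj.mul ≫ coalg.comul
  frobenius_right : coalg.comul ▷ alg.X ≫ (α_ _ _ _).hom ≫ alg.X ◁ MonObj.mul =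
    MonObj.mul ≫ coalg.comul

instance {C : Type u} [Category.{v} C] [MonoidalCategory C] [Preadditive C] [MonoidalPreadditive C]
    (A B : Mon C) : HasZeroMorphisms (Bimod A B) where
  zero X Y := ⟨{ hom := 0, left_act_hom := by simp, right_act_hom := by simp }⟩
  comp_zero f Z := Bimod.hom_ext _ _ (comp_zero (f := f.hom))
  zero_comp X Y Z f := Bimod.hom_ext _ _ (zero_comp (f := f.hom))

namespace FrobeniusAlgebra
section
variable {C : Type u} [Category.{v} C] [MonoidalCategory C]

/-- Simple: `A` is simple as a bimodule over itself. -/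
def IsSimple [Preadditive C] [MonoidalPreadditive C] (A : FrobeniusAlgebra C) : Prop :=
  Simple (Bimod.regular A.alg)

variable [RigidCategory C] [PivotalCategory C]

/-- Special: nonzero dimension, `μ ∘ Δ = id` and `ε ∘ η = dim`. -/
structure IsSpecial [Preadditive C] (A : FrobeniusAlgebra C) : Prop where
  dim_ne_zero : PivotalCategory.dim A.alg.X ≠ 0
  comul_mul : A.coalg.comul ≫ MonObj.mul = 𝟙 A.alg.X
  one_counit : MonObj.one ≫ A.coalg.counit = PivotalCategory.dim A.alg.X

/-- Symmetric: the two morphisms from `A` to its dual built from `ε ∘ μ` and the right,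
respectively left, coevaluation coincide. -/
def IsSymmetric (A : FrobeniusAlgebra C) : Prop :=
  (ρ_ A.alg.X).inv ≫ A.alg.X ◁ η_ A.alg.X A.alg.Xᘁ ≫ (α_ _ _ _).inv ≫
      (MonObj.mul ≫ A.coalg.counit) ▷ A.alg.Xᘁ ≫ (λ_ _).hom =
    (λ_ A.alg.X).inv ≫ PivotalCategory.coevL A.alg.X ▷ A.alg.X ≫ (α_ _ _ _).hom ≫
      A.alg.Xᘁ ◁ (MonObj.mul ≫ A.coalg.counit) ≫ (ρ_ _).hom
end
end FrobeniusAlgebra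

namespace InternalNat
section
variable (k : Type w) [Field k] [IsAlgClosed k] {C : Type u} [Category.{v} C] [MonoidalCategory C]
    [Abelian C] [Linear k C] [MonoidalPreadditive C] [MonoidalLinear k C] [RigidCategory C]
    [FusionCategory k C] [BraidedCategory C] [ModularBraiding k C] {A B D : Mon C}

/-- The internal natural transformations from `- ⊗_A X` to `- ⊗_A Y`, an object of the Drinfeld
center together with its universal property. -/
def iNat (X Y : Bimod A B) :
    InternalHom (Center C) (RightMod.tensFun X) (RightMod.tensFun Y) :=
  Classical.choice (ModHom.exists_internalHom (k := k) X (RightMod.tensFun Y))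

/-- The object of internal natural transformations. -/
abbrev DD (X Y : Bimod A B) : Center C := (iNat k X Y).obj

/-- Vertical composition: the canonical composition of internal Homs. -/
def muVer (X Y Z : Bimod A B) : DD k Y Z ⊗ DD k X Y ⟶ DD k X Z :=
  InternalHom.mul (iNat k Y Z) (iNat k X Y) (iNat k X Z)

/-- Left horizontal composition, determined by the universal property from the left horizontal
composite of the two universal transformations, the composite functors being identified with
`- ⊗ (X₁ ⊗ X₂)` and `- ⊗ (X₃ ⊗ X₄)`. -/
def muHorL (X₁ : Bimod A B) (X₂ : Bimod B D) (X₃ : Bimod A B) (X₄ : Bimod B D) :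
    DD k X₂ X₄ ⊗ DD k X₁ X₃ ⟶ DD k (X₁.tensorBimod X₂) (X₃.tensorBimod X₄) :=
  (iNat k (X₁.tensorBimod X₂) (X₃.tensorBimod X₄)).curry
    ((DD k X₂ X₄ ⊗ DD k X₁ X₃) ⊴ₗ (RightMod.assocIso X₁ X₂).inv ≫
      ModFun.hcompL _ _ _ _ _ _ (iNat k X₂ X₄).ev (iNat k X₁ X₃).ev ≫
        (RightMod.assocIso X₃ X₄).hom)
end
end InternalNat

end

/-!
In a left module category over `V`, a morphism `x ⊙ m ⟶ n` is a morphism `m ⟶ n` of degree `x`.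
Composition of graded morphisms multiplies degrees, and vertical composition is the composition of
universal graded transformations. The left horizontal composite of `f : Z ⊙ G₂ ⟶ G₄` and
`g : W ⊙ G₁ ⟶ G₃` is the graded composite of two whiskerings: first `g` followed by `G₂`, then `f`
preceded by `G₃`. Compatibility of `f` with the module constraints says precisely that these two
whiskerings commute up to the half-braiding of `Z`. Exchanging the middle two factors of a fourfold
graded composite in this way gives the interchange law of module transformations, with the braiding
acting on degrees, and the universal property of internal Homs turns it into the Eckmann–Hilton
relation.
-/

section GradedHom
variable {V : Type u} [Category.{v} V] [MonoidalCategory V]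
    {M : Type u₁} [Category.{v₁} M] [MonoidalLeftAction V M]

/-- In a left module category, a morphism `x ⊙ m ⟶ n` is a morphism `m ⟶ n` of degree `x`; this
is the composition of such graded morphisms, under which degrees multiply. -/
noncomputable def gradedComp {x y : V} {l m n : M} (f : x ⊙ₗ m ⟶ n) (g : y ⊙ₗ l ⟶ m) :
    (x ⊗ y) ⊙ₗ l ⟶ n :=
  (αₗ x y l).hom ≫ x ⊴ₗ g ≫ f

theorem gradedComp_assoc {x y z : V} {k l m n : M} (f : x ⊙ₗ m ⟶ n) (g : y ⊙ₗ l ⟶ m)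
    (h : z ⊙ₗ k ⟶ l) :
    gradedComp (gradedComp f g) h =
      (α_ x y z).hom ⊵ₗ k ≫ gradedComp f (gradedComp g h) := by
  simp [gradedComp, associator_actionHom_assoc]

theorem gradedComp_actionHomLeft_comp_right {x y y' : V} {l m n : M} (b : y ⟶ y')
    (f : x ⊙ₗ m ⟶ n) (g : y' ⊙ₗ l ⟶ m) :
    gradedComp f (b ⊵ₗ l ≫ g) = (x ◁ b) ⊵ₗ l ≫ gradedComp f g := by
  simp [gradedComp]

theorem gradedComp_actionHomLeft_comp_left {x x' y : V} {l m n : M} (a : x ⟶ x')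
    (f : x' ⊙ₗ m ⟶ n) (g : y ⊙ₗ l ⟶ m) :
    gradedComp (a ⊵ₗ m ≫ f) g = (a ▷ y) ⊵ₗ l ≫ gradedComp f g := by
  simp [gradedComp, action_exchange_assoc]

theorem tensorHom_gradedComp {x x' y y' : V} {l m n : M} (a : x ⟶ x') (b : y ⟶ y')
    (f : x' ⊙ₗ m ⟶ n) (g : y' ⊙ₗ l ⟶ m) :
    (a ⊗ₘ b) ⊵ₗ l ≫ gradedComp f g = gradedComp (a ⊵ₗ m ≫ f) (b ⊵ₗ l ≫ g) := by
  rw [gradedComp_actionHomLeft_comp_left, gradedComp_actionHomLeft_comp_right,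
    MonoidalCategory.tensorHom_def, comp_actionHomLeft, Category.assoc]

theorem gradedComp_conj {x y : V} {l l' m m' n n' : M} (f : x ⊙ₗ m ⟶ n) (g : y ⊙ₗ l ⟶ m)
    (d : l' ⟶ l) (e : m ≅ m') (h : n ⟶ n') :
    gradedComp (x ⊴ₗ e.inv ≫ f ≫ h) (y ⊴ₗ d ≫ g ≫ e.hom) =
      (x ⊗ y) ⊴ₗ d ≫ gradedComp f g ≫ h := by
  simp [gradedComp]

theorem gradedComp_interchange [BraidedCategory V] {z y w v : V} {j k l l' m n : M}
    (p : z ⊙ₗ m ⟶ n) (q : y ⊙ₗ l ⟶ m) (r : w ⊙ₗ k ⟶ l) (s : v ⊙ₗ j ⟶ k)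
    (r' : w ⊙ₗ l' ⟶ m) (q' : y ⊙ₗ k ⟶ l')
    (h : gradedComp q r = (β_ y w).hom ⊵ₗ k ≫ gradedComp r' q') :
    gradedComp (gradedComp p q) (gradedComp r s) =
      tensorμ z y w v ⊵ₗ j ≫ gradedComp (gradedComp p r') (gradedComp q' s) := by
  have middle : gradedComp q (gradedComp r s) =
      ((α_ y w v).inv ≫ (β_ y w).hom ▷ v ≫ (α_ w y v).hom) ⊵ₗ j ≫
        gradedComp r' (gradedComp q' s) := by
    simp only [comp_actionHomLeft, Category.assoc, ← gradedComp_assoc,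
      ← gradedComp_actionHomLeft_comp_left, ← h]
    rw [gradedComp_assoc, inv_hom_actionHomLeft_assoc]
  rw [gradedComp_assoc, middle, gradedComp_actionHomLeft_comp_right, gradedComp_assoc p r', tensorμ]
  simp only [whiskerLeft_comp, comp_actionHomLeft, Category.assoc, inv_hom_actionHomLeft_assoc]

variable {N : Type u₂} [Category.{v₂} N] [MonoidalLeftAction V N] (F : M ⥤ N) [F.LaxLeftLinear V]

/-- The action on graded morphisms of a functor that is lax linear over the grading category. -/
noncomputable def gradedMap {x : V} {m n : M} (f : x ⊙ₗ m ⟶ n) : x ⊙ₗ F.obj m ⟶ F.obj n :=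
  μₗ F x m ≫ F.map f

theorem gradedMap_gradedComp {x y : V} {l m n : M} (f : x ⊙ₗ m ⟶ n) (g : y ⊙ₗ l ⟶ m) :
    gradedMap F (gradedComp f g) = gradedComp (gradedMap F f) (gradedMap F g) := by
  simp [gradedMap, gradedComp]

theorem gradedMap_actionHomLeft_comp {x y : V} {m n : M} (a : x ⟶ y) (f : y ⊙ₗ m ⟶ n) :
    gradedMap F (a ⊵ₗ m ≫ f) = a ⊵ₗ F.obj m ≫ gradedMap F f := by
  simp [gradedMap]

theorem gradedComp_gradedMap_of_comm (G : M ⥤ N) [G.LaxLeftLinear V] {z x : V} {m n : M}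
    (e : z ⊗ x ≅ x ⊗ z) (g : x ⊙ₗ m ⟶ n) {t : z ⊙ₗ F.obj m ⟶ G.obj m}
    {t' : z ⊙ₗ F.obj n ⟶ G.obj n} {s : z ⊙ₗ F.obj (x ⊙ₗ m) ⟶ G.obj (x ⊙ₗ m)}
    (natural : z ⊴ₗ F.map g ≫ t' = s ≫ G.map g)
    (comm : ((αₗ x z (F.obj m)).inv ≫ e.inv ⊵ₗ F.obj m ≫ (αₗ z x (F.obj m)).hom ≫
      z ⊴ₗ μₗ F x m) ≫ s = x ⊴ₗ t ≫ μₗ G x m) :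
    gradedComp t' (gradedMap F g) = e.hom ⊵ₗ F.obj m ≫ gradedComp (gradedMap G g) t := by
  have half_braided : (αₗ z x (F.obj m)).hom ≫ z ⊴ₗ μₗ F x m ≫ s =
      e.hom ⊵ₗ F.obj m ≫ (αₗ x z (F.obj m)).hom ≫ x ⊴ₗ t ≫ μₗ G x m := by
    rw [← comm]
    simp
  simp only [gradedComp, gradedMap, actionHomRight_comp, Category.assoc, natural]
  rw [reassoc_of% half_braided]
end GradedHom

namespace ModFun
variable {C : Type u} [Category.{v} C] [MonoidalCategory C]
    {M : Type u₁} [Category.{v₁} M] [MonoidalLeftAction C M]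
    {N : Type u₂} [Category.{v₂} N] [MonoidalLeftAction C N]
    {P : Type u₃} [Category.{v₃} P] [MonoidalLeftAction C P]

theorem gradedComp_app {G H K : ModFun C M N} {Z W : Center C} (f : Z ⊙ₗ H ⟶ K) (g : W ⊙ₗ G ⟶ H)
    (m : M) :
    (gradedComp f g).τ.app m = gradedComp (x := Z.1) (y := W.1) (f.τ.app m) (g.τ.app m) :=
  rfl

/-- Whiskering of a graded module transformation by a module functor applied first. -/
noncomputable def gradedWhiskerL (G : ModFun C M N) {H K : ModFun C N P} {Z : Center C}
    (f : Z ⊙ₗ H ⟶ K) : Z ⊙ₗ comp G H ⟶ comp G K :=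
  compAct Z G H ≫ whiskerL G f

/-- Whiskering of a graded module transformation by a module functor applied last. -/
noncomputable def gradedWhiskerR {G H : ModFun C M N} {Z : Center C} (f : Z ⊙ₗ G ⟶ H)
    (K : ModFun C N P) : Z ⊙ₗ comp G K ⟶ comp H K :=
  actComp Z G K ≫ whiskerR f K

theorem gradedWhiskerL_app (G : ModFun C M N) {H K : ModFun C N P} {Z : Center C}
    (f : Z ⊙ₗ H ⟶ K) (m : M) : (gradedWhiskerL G f).τ.app m = f.τ.app (G.F.obj m) :=
  Category.id_comp _

theorem gradedWhiskerR_app {G H : ModFun C M N} {Z : Center C} (f : Z ⊙ₗ G ⟶ H)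
    (K : ModFun C N P) (m : M) :
    (gradedWhiskerR f K).τ.app m = gradedMap (x := Z.1) K.F (f.τ.app m) :=
  rfl

theorem hcompL_eq_gradedComp {G₁ G₃ : ModFun C M N} {G₂ G₄ : ModFun C N P} {Z W : Center C}
    (f : Z ⊙ₗ G₂ ⟶ G₄) (g : W ⊙ₗ G₁ ⟶ G₃) :
    hcompL G₁ G₃ G₂ G₄ Z W f g = gradedComp (gradedWhiskerL G₃ f) (gradedWhiskerR g G₂) := by
  simp only [hcompL, gradedComp, gradedWhiskerL, gradedWhiskerR, actionHomRight_comp,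
    Category.assoc]

theorem gradedWhiskerL_gradedComp (G : ModFun C M N) {H K L : ModFun C N P} {Z W : Center C}
    (f : Z ⊙ₗ K ⟶ L) (g : W ⊙ₗ H ⟶ K) :
    gradedWhiskerL G (gradedComp f g) =
      gradedComp (gradedWhiskerL G f) (gradedWhiskerL G g) := by
  ext m
  rw [gradedWhiskerL_app, gradedComp_app, gradedComp_app, gradedWhiskerL_app, gradedWhiskerL_app]
  rfl

theorem gradedWhiskerR_gradedComp {G H K : ModFun C M N} {Z W : Center C} (f : Z ⊙ₗ H ⟶ K)
    (g : W ⊙ₗ G ⟶ H) (L : ModFun C N P) :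
    gradedWhiskerR (gradedComp f g) L =
      gradedComp (gradedWhiskerR f L) (gradedWhiskerR g L) := by
  ext m
  exact gradedMap_gradedComp L.F (f.τ.app m) (g.τ.app m)

theorem gradedWhiskerL_actionHomLeft_comp (G : ModFun C M N) {H K : ModFun C N P} {Z W : Center C}
    (a : Z ⟶ W) (f : W ⊙ₗ H ⟶ K) :
    gradedWhiskerL G (a ⊵ₗ H ≫ f) = a ⊵ₗ comp G H ≫ gradedWhiskerL G f := by
  ext m
  rw [gradedWhiskerL_app, comp_τ, comp_τ, NatTrans.comp_app, NatTrans.comp_app,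
    gradedWhiskerL_app]
  rfl

theorem gradedWhiskerR_actionHomLeft_comp {G H : ModFun C M N} {Z W : Center C}
    (a : Z ⟶ W) (f : W ⊙ₗ G ⟶ H) (K : ModFun C N P) :
    gradedWhiskerR (a ⊵ₗ G ≫ f) K = a ⊵ₗ comp G K ≫ gradedWhiskerR f K := by
  ext m
  exact gradedMap_actionHomLeft_comp K.F a.f (f.τ.app m)

theorem gradedComp_app_gradedMap {H K : ModFun C N P} {Z : Center C} (f : Z ⊙ₗ H ⟶ K)
    {x : C} {m n : N} (g : x ⊙ₗ m ⟶ n) :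
    gradedComp (x := Z.1) (f.τ.app n) (gradedMap H.F g) =
      (Z.2.β x).hom ⊵ₗ H.F.obj m ≫ gradedComp (gradedMap K.F g) (f.τ.app m) :=
  gradedComp_gradedMap_of_comm H.F K.F (Z.2.β x) g (f.τ.naturality g) (f.comm x m)

theorem gradedWhisker_exchange {G G' : ModFun C M N} {H K : ModFun C N P} {Z W : Center C}
    (f : Z ⊙ₗ H ⟶ K) (g : W ⊙ₗ G ⟶ G') :
    gradedComp (gradedWhiskerL G' f) (gradedWhiskerR g H) =
      (β_ Z W).hom ⊵ₗ comp G H ≫ gradedComp (gradedWhiskerR g K) (gradedWhiskerL G f) := by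
  ext m
  rw [comp_τ, NatTrans.comp_app, gradedComp_app, gradedComp_app, gradedWhiskerL_app,
    gradedWhiskerL_app, gradedWhiskerR_app, gradedWhiskerR_app]
  exact gradedComp_app_gradedMap f (g.τ.app m)

theorem tensorHom_hcompL {G₁ G₃ : ModFun C M N} {G₂ G₄ : ModFun C N P} {Z Z' W W' : Center C}
    (a : Z ⟶ Z') (b : W ⟶ W') (f : Z' ⊙ₗ G₂ ⟶ G₄) (g : W' ⊙ₗ G₁ ⟶ G₃) :
    (a ⊗ₘ b) ⊵ₗ comp G₁ G₂ ≫ hcompL G₁ G₃ G₂ G₄ Z' W' f g =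
      hcompL G₁ G₃ G₂ G₄ Z W (a ⊵ₗ G₂ ≫ f) (b ⊵ₗ G₁ ≫ g) := by
  simp only [hcompL_eq_gradedComp, tensorHom_gradedComp, gradedWhiskerL_actionHomLeft_comp,
    gradedWhiskerR_actionHomLeft_comp]

theorem hcompL_interchange {G₁ G₃ G₅ : ModFun C M N} {G₂ G₄ G₆ : ModFun C N P}
    {Z Y W U : Center C} (f : Z ⊙ₗ G₄ ⟶ G₆) (f' : Y ⊙ₗ G₂ ⟶ G₄) (g : W ⊙ₗ G₃ ⟶ G₅)
    (g' : U ⊙ₗ G₁ ⟶ G₃) :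
    hcompL G₁ G₅ G₂ G₆ (Z ⊗ Y) (W ⊗ U) (gradedComp f f') (gradedComp g g') =
      tensorμ Z Y W U ⊵ₗ comp G₁ G₂ ≫
        gradedComp (hcompL G₃ G₅ G₄ G₆ Z W f g) (hcompL G₁ G₃ G₂ G₄ Y U f' g') := by
  simp only [hcompL_eq_gradedComp, gradedWhiskerL_gradedComp, gradedWhiskerR_gradedComp]
  exact gradedComp_interchange _ _ _ _ _ _ (gradedWhisker_exchange f' g)
end ModFun

namespace InternalHom
section
variable {V : Type u} [Category.{v} V] [MonoidalCategory V]
    {M : Type u₁} [Category.{v₁} M] [MonoidalLeftAction V M]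

theorem hom_ext {m n : M} (a : InternalHom V m n) {x : V} {f g : x ⟶ a.obj}
    (h : f ⊵ₗ m ≫ a.ev = g ⊵ₗ m ≫ a.ev) : f = g :=
  (a.uniq _ f h).trans (a.uniq _ g rfl).symm

theorem mul_ev {l m n : M} (a : InternalHom V m n) (b : InternalHom V l m)
    (c : InternalHom V l n) :
    mul a b c ⊵ₗ l ≫ c.ev = gradedComp a.ev b.ev :=
  c.curry_ev _

theorem tensorHom_mul_ev {l m n : M} (a : InternalHom V m n) (b : InternalHom V l m)
    (c : InternalHom V l n) {x y : V} (f : x ⟶ a.obj) (g : y ⟶ b.obj) :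
    ((f ⊗ₘ g) ≫ mul a b c) ⊵ₗ l ≫ c.ev = gradedComp (f ⊵ₗ m ≫ a.ev) (g ⊵ₗ l ≫ b.ev) := by
  rw [comp_actionHomLeft, Category.assoc, mul_ev, tensorHom_gradedComp]
end

variable {C : Type u} [Category.{v} C] [MonoidalCategory C]
    {M : Type u₁} [Category.{v₁} M] [MonoidalLeftAction C M]
    {N : Type u₂} [Category.{v₂} N] [MonoidalLeftAction C N]
    {P : Type u₃} [Category.{v₃} P] [MonoidalLeftAction C P]
    {G₁ G₃ : ModFun C M N} {G₂ G₄ : ModFun C N P} {K K' : ModFun C M P}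

/-- Left horizontal composition of internal natural transformations. The module functors `K` and
`K'` are models of the composite functors, identified with them by `e` and `e'`. -/
noncomputable def hmulL (a : InternalHom (Center C) G₂ G₄) (b : InternalHom (Center C) G₁ G₃)
    (c : InternalHom (Center C) K K') (e : ModFun.comp G₁ G₂ ≅ K) (e' : ModFun.comp G₃ G₄ ≅ K') :
    a.obj ⊗ b.obj ⟶ c.obj :=
  c.curry ((a.obj ⊗ b.obj) ⊴ₗ e.inv ≫ ModFun.hcompL _ _ _ _ _ _ a.ev b.ev ≫ e'.hom)

theorem hmulL_ev (a : InternalHom (Center C) G₂ G₄) (b : InternalHom (Center C) G₁ G₃)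
    (c : InternalHom (Center C) K K') (e : ModFun.comp G₁ G₂ ≅ K) (e' : ModFun.comp G₃ G₄ ≅ K') :
    hmulL a b c e e' ⊵ₗ K ≫ c.ev =
      (a.obj ⊗ b.obj) ⊴ₗ e.inv ≫ ModFun.hcompL _ _ _ _ _ _ a.ev b.ev ≫ e'.hom :=
  c.curry_ev _

theorem tensorHom_hmulL_ev (a : InternalHom (Center C) G₂ G₄) (b : InternalHom (Center C) G₁ G₃)
    (c : InternalHom (Center C) K K') (e : ModFun.comp G₁ G₂ ≅ K) (e' : ModFun.comp G₃ G₄ ≅ K')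
    {Z W : Center C} (f : Z ⟶ a.obj) (g : W ⟶ b.obj) :
    ((f ⊗ₘ g) ≫ hmulL a b c e e') ⊵ₗ K ≫ c.ev =
      (Z ⊗ W) ⊴ₗ e.inv ≫
        ModFun.hcompL _ _ _ _ _ _ (f ⊵ₗ G₂ ≫ a.ev) (g ⊵ₗ G₁ ≫ b.ev) ≫ e'.hom := by
  rw [comp_actionHomLeft, Category.assoc, hmulL_ev, ← action_exchange_assoc,
    reassoc_of% @ModFun.tensorHom_hcompL]
end InternalHom

theorem mainTheorem4_general {C : Type u} [Category.{v} C] [MonoidalCategory C]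
    {M : Type u₁} [Category.{v₁} M] [MonoidalLeftAction C M]
    {N : Type u₂} [Category.{v₂} N] [MonoidalLeftAction C N]
    {P : Type u₃} [Category.{v₃} P] [MonoidalLeftAction C P]
    {G₁ G₃ G₅ : ModFun C M N} {G₂ G₄ G₆ : ModFun C N P} {K₁₂ K₃₄ K₅₆ : ModFun C M P}
    (e₁₂ : ModFun.comp G₁ G₂ ≅ K₁₂) (e₃₄ : ModFun.comp G₃ G₄ ≅ K₃₄)
    (e₅₆ : ModFun.comp G₅ G₆ ≅ K₅₆)
    (d₁₃ : InternalHom (Center C) G₁ G₃) (d₃₅ : InternalHom (Center C) G₃ G₅)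
    (d₁₅ : InternalHom (Center C) G₁ G₅) (d₂₄ : InternalHom (Center C) G₂ G₄)
    (d₄₆ : InternalHom (Center C) G₄ G₆) (d₂₆ : InternalHom (Center C) G₂ G₆)
    (k₁₃ : InternalHom (Center C) K₁₂ K₃₄) (k₃₅ : InternalHom (Center C) K₃₄ K₅₆)
    (k₁₅ : InternalHom (Center C) K₁₂ K₅₆) :
    (d₄₆.mul d₂₄ d₂₆ ⊗ₘ d₃₅.mul d₁₃ d₁₅) ≫ d₂₆.hmulL d₁₅ k₁₅ e₁₂ e₅₆ =
      tensorμ d₄₆.obj d₂₄.obj d₃₅.obj d₁₃.obj ≫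
        (d₄₆.hmulL d₃₅ k₃₅ e₃₄ e₅₆ ⊗ₘ d₂₄.hmulL d₁₃ k₁₃ e₁₂ e₃₄) ≫ k₃₅.mul k₁₃ k₁₅ := by
  apply k₁₅.hom_ext
  rw [InternalHom.tensorHom_hmulL_ev, InternalHom.mul_ev, InternalHom.mul_ev,
    ModFun.hcompL_interchange, comp_actionHomLeft, Category.assoc, Category.assoc,
    InternalHom.tensorHom_mul_ev, InternalHom.hmulL_ev, InternalHom.hmulL_ev, gradedComp_conj,
    action_exchange_assoc]

theorem mainTheorem4 (k : Type w) [Field k] [IsAlgClosed k] [CharZero k]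
    (C : Type u) [Category.{v} C] [MonoidalCategory C] [Abelian C] [Linear k C]
    [MonoidalPreadditive C] [MonoidalLinear k C] [RigidCategory C] [FusionCategory k C]
    [PivotalCategory C] [SphericalCategory C] [BraidedCategory C] [ModularBraiding k C]
    (A A' A'' : FrobeniusAlgebra C)
    (hA : A.IsSimple ∧ A.IsSpecial ∧ A.IsSymmetric)
    (hA' : A'.IsSimple ∧ A'.IsSpecial ∧ A'.IsSymmetric)
    (hA'' : A''.IsSimple ∧ A''.IsSpecial ∧ A''.IsSymmetric)
    (X₁ X₃ X₅ : Bimod A.alg A'.alg) (X₂ X₄ X₆ : Bimod A'.alg A''.alg) :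
    (InternalNat.muVer k X₂ X₄ X₆ ⊗ₘ InternalNat.muVer k X₁ X₃ X₅) ≫
        InternalNat.muHorL k X₁ X₂ X₅ X₆ =
      tensorμ (InternalNat.DD k X₄ X₆) (InternalNat.DD k X₂ X₄)
          (InternalNat.DD k X₃ X₅) (InternalNat.DD k X₁ X₃) ≫
        (InternalNat.muHorL k X₃ X₄ X₅ X₆ ⊗ₘ InternalNat.muHorL k X₁ X₂ X₃ X₄) ≫
          InternalNat.muVer k (X₁.tensorBimod X₂) (X₃.tensorBimod X₄)
            (X₅.tensorBimod X₆) :=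
  mainTheorem4_general (RightMod.assocIso X₁ X₂) (RightMod.assocIso X₃ X₄)
    (RightMod.assocIso X₅ X₆) _ _ _ _ _ _ _ _ _
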